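/- Let $\Gamma$ be a finite simple graph with vertex set $V\Gamma$, let $G_\Gamma=\langle V\Gamma \mid [v,w]=1 \text{ if } v,w \text{ are adjacent}\rangle$ be the associated right-angled Artin group, and let $\widetilde S_\Gamma$ be the universal cover of the Salvetti complex $S_\Gamma$ (the cube complex with one $|\sigma|$-cube, glued up to a torus, for every clique $\sigma$ of $\Gamma$). Thus $\widetilde S_\Gamma$ is a CAT(0) cube complex on which $G_\Gamma$ acts by deck transformations, and whose 1-skeleton is the Cayley graph of $G_\Gamma$ with respect to $V\Gamma$. Let $\mathfrak H$ be the set of halfspaces of $\widetilde S_\Gamma$; the hyperplane bounding $h\in\mathfrak H$ is denoted by $\partial h$. Embed the vertex set of $\widetilde S_\Gamma$ in $\{0,1\}^{\mathfrak H}$ (with the product topology) by sending $x$ to the indicator function of $\{h: x\in h\}$. The Roller boundary $\partial_R\widetilde S_\Gamma$ is the closure of the image minus the image, with its Borel $\sigma$-algebra; for $\xi\in\partial_R\widetilde S_\Gamma$ let $U_\xi=\{h\in\mathfrak H:\xi(h)=1\}$. Two hyperplanes are strongly separated if no hyperplane intersects both of them. A point $\xi$ is regular if for all $h_1,h_2\in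 U_\xi$ there is $k\in U_\xi$ with $k\subseteq h_1\cap h_2$ such that $\partial k$ is strongly separated from $\partial h_1$ and from $\partial h_2$; let $\partial_{\mathrm{reg}}\widetilde S_\Gamma$ be the set of regular points. A geodesic ray $r$ in the 1-skeleton, starting at a vertex (a combinatorial geodesic ray), represents $\xi$ if $U_\xi$ is the set of halfspaces that virtually contain $r$, i.e. contain $r$ up to a finite initial segment. For a full subgraph $\Lambda\subseteq\Gamma$, a standard subcomplex of type $\Lambda$ is a connected component of the inverse image of $S_\Lambda\subseteq S_\Gamma$ in $\widetilde S_\Gamma$; it is a join standard subcomplex if $\Lambda$ is the join of two nonempty full subgraphs. Let $\mathbb S_J$ be the countable set, with the discrete topology, of all standard subcomplexes that are contained in some join standard subcomplex. Then: 1. $\partial_{\mathrm{reg}}\widetilde S_\Gamma$ is a Borel subset of $\partial_R\widetilde S_\Gamma$. 2. For every non-regular point $\xi\in\partial_R\widetilde S_\Gamma$ there is a unique standard subcomplex $Y$ such that, for every combinatorial geodesic ray $r$ representing $\xi$, $Y$ is the smallest standard subcomplex that virtually contains $r$. 3. There is a unique Borel $G_\Gamma$-equivariant map $\Phi:\partial_R\widetilde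 S_\Gamma\setminus\partial_{\mathrm{reg}}\widetilde S_\Gamma\to\mathbb S_J$ such that, for every non-regular point $\xi$ and every combinatorial geodesic ray $r$ representing $\xi$, $\Phi(\xi)$ is the smallest standard subcomplex of $\widetilde S_\Gamma$ that virtually contains $r$. -/

import Mathlib

open scoped Pointwise

namespace Salvetti

universe u

variable {V : Type u}

/-! ### Right-angled Artin groups -/

/-- The relators `[v, w]`, one for every pair of adjacent vertices of `Γ`. -/
def relators (Γ : SimpleGraph V) : Set (FreeGroup V) :=
  {x | ∃ v w, Γ.Adj v w ∧
    x = FreeGroup.of v * FreeGroup.of w * (FreeGroup.of v)⁻¹ * (FreeGroup.of w)⁻¹}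

/-- The right-angled Artin group with defining graph `Γ`. -/
abbrev RAAG (Γ : SimpleGraph V) : Type u := PresentedGroup (relators Γ)

/-- The standard generator attached to a vertex of `Γ`. -/
def gen (Γ : SimpleGraph V) (v : V) : RAAG Γ := PresentedGroup.of v

/-- `Λ` (a set of vertices, standing for the full subgraph it spans) admits a nontrivial join
decomposition. -/
def IsJoin (Γ : SimpleGraph V) (Λ : Set V) : Prop :=
  ∃ A B : Set V, A.Nonempty ∧ B.Nonempty ∧ Disjoint A B ∧ A ∪ B = Λ ∧
    ∀ a ∈ A, ∀ b ∈ B, Γ.Adj a b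

/-! ### The Salvetti complex and its universal cover -/

/-- The cubes of the Salvetti complex of `Γ`: one cube for every clique `σ` of `Γ`, of dimension
`|σ|` (the empty clique is the only vertex, and a clique `σ` gives the torus spanned by the
loops `v ∈ σ`). For `v ∈ σ`, both faces of the cube `σ` in the direction `v` are glued
to the cube `σ \ {v}`. -/
def SalvettiCube (Γ : SimpleGraph V) : Type u := {σ : Set V // Γ.IsClique σ}

/-- The subcomplex of the Salvetti complex of `Γ` that is the Salvetti complex of the full subgraph
spanned by `Λ`. -/
def salvettiSub (Γ : SimpleGraph V) (Λ : Set V) : Set (SalvettiCube Γ) := {σ | σ.1 ⊆ Λ}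

/-- The cubes of the universal cover of the Salvetti complex. Its vertex set is the group, and
the lifts of the cube `σ` are indexed by the group: the lift based at `g` has as its vertices
the products `g * ∏ v ∈ τ, v` for `τ ⊆ σ`. -/
@[ext]
structure Cube (Γ : SimpleGraph V) where
  /-- the initial vertex of the cube -/
  base : RAAG Γ
  /-- the labels of the edges at the initial vertex -/
  dirs : Set V
  /-- the labels span a clique -/
  isClique : Γ.IsClique dirs

/-- The covering map from the universal cover to the Salvetti complex, on cubes. -/
def covering (Γ : SimpleGraph V) (c : Cube Γ) : SalvettiCube Γ := ⟨c.dirs, c.isClique⟩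

/-- `c'` is a codimension one face of `c`: one of the two faces of `c` orthogonal to a direction
`v` of `c`. -/
def IsFacet {Γ : SimpleGraph V} (c' c : Cube Γ) : Prop :=
  ∃ v ∈ c.dirs, c'.dirs = c.dirs \ {v} ∧ (c'.base = c.base ∨ c'.base = c.base * gen Γ v)

/-- The vertices, as cubes of dimension zero. -/
def vertexCube (Γ : SimpleGraph V) (g : RAAG Γ) : Cube Γ :=
  ⟨g, ∅, by simp [SimpleGraph.IsClique]⟩

/-- The edges of the universal cover: the edge with label `v` based at `g` joins `g` to `g * v`. -/
@[ext]
structure Edge (Γ : SimpleGraph V) where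
  /-- the initial vertex -/
  base : RAAG Γ
  /-- the label -/
  label : V

/-- An edge as a cube of dimension one. -/
def Edge.toCube {Γ : SimpleGraph V} (e : Edge Γ) : Cube Γ :=
  ⟨e.base, {e.label}, by simp [SimpleGraph.IsClique]⟩

/-- The pair of endpoints of an edge. -/
def Edge.ends {Γ : SimpleGraph V} (e : Edge Γ) : Sym2 (RAAG Γ) :=
  s(e.base, e.base * gen Γ e.label)

/-- The 1-skeleton of the universal cover; its path metric is `SimpleGraph.dist`. -/
def oneSkeleton (Γ : SimpleGraph V) : SimpleGraph (RAAG Γ) :=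
  SimpleGraph.fromEdgeSet (Set.range (Edge.ends (Γ := Γ)))

/-! ### Standard subcomplexes -/

/-- The connected component of the cube `c` in the subcomplex with set of cubes `S`. -/
def component {Γ : SimpleGraph V} (S : Set (Cube Γ)) (c : Cube Γ) : Set (Cube Γ) :=
  {c' | Relation.ReflTransGen
    (fun a b => a ∈ S ∧ b ∈ S ∧ (IsFacet a b ∨ IsFacet b a)) c c'}

/-- `Y` (a subcomplex, given by its cubes) is a standard subcomplex of type `Λ`: a connected
component of the inverse image of the Salvetti complex of `Λ` under the covering map. -/
def IsStandardOfType (Γ : SimpleGraph V) (Λ : Set V) (Y : Set (Cube Γ)) : Prop :=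
  ∃ c ∈ covering Γ ⁻¹' salvettiSub Γ Λ, Y = component (covering Γ ⁻¹' salvettiSub Γ Λ) c

/-- `Y` is a standard subcomplex. -/
def IsStandard (Γ : SimpleGraph V) (Y : Set (Cube Γ)) : Prop :=
  ∃ Λ : Set V, IsStandardOfType Γ Λ Y

/-- `Y` is a join standard subcomplex. -/
def IsJoinStandard (Γ : SimpleGraph V) (Y : Set (Cube Γ)) : Prop :=
  ∃ Λ : Set V, IsJoin Γ Λ ∧ IsStandardOfType Γ Λ Y

/-- The set of all standard subcomplexes that are contained in some join standard subcomplex. -/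
def StandardInJoin (Γ : SimpleGraph V) : Type u :=
  {Y : Set (Cube Γ) // IsStandard Γ Y ∧ ∃ Z, IsJoinStandard Γ Z ∧ Y ⊆ Z}

/-- The countable set `StandardInJoin Γ` is discrete. -/
instance (Γ : SimpleGraph V) : MeasurableSpace (StandardInJoin Γ) := ⊤

/-! ### Hyperplanes and halfspaces -/

/-- `e` and `e'` are opposite edges of a square: the square based at `e.base` whose directions are
the label of `e` and a vertex `w` adjacent to it. -/
def OppositeEdges {Γ : SimpleGraph V} (e e' : Edge Γ) : Prop :=
  e'.label = e.label ∧ ∃ w, Γ.Adj e.label w ∧ e'.base = e.base * gen Γ w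

/-- The hyperplanes: classes of edges under the equivalence relation generated by being opposite
in a square. -/
def Hyperplane (Γ : SimpleGraph V) : Type u := Quot (OppositeEdges (Γ := Γ))

/-- The hyperplane dual to an edge. -/
def Edge.dual {Γ : SimpleGraph V} (e : Edge Γ) : Hyperplane Γ := Quot.mk _ e

/-- Two hyperplanes have nonempty intersection: they are equal, or they are dual to two
adjacent edges of a square. -/
def Hyperplane.Meets {Γ : SimpleGraph V} (H K : Hyperplane Γ) : Prop :=
  H = K ∨ ∃ (g : RAAG Γ) (v w : V), Γ.Adj v w ∧
    Edge.dual ⟨g, v⟩ = H ∧ Edge.dual ⟨g, w⟩ = K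

/-- Two hyperplanes are strongly separated if no hyperplane meets both of them. -/
def StronglySeparated {Γ : SimpleGraph V} (H K : Hyperplane Γ) : Prop :=
  ¬ ∃ L : Hyperplane Γ, L.Meets H ∧ L.Meets K

/-- The 1-skeleton with the (open) edges dual to `H` removed. -/
def Hyperplane.complement {Γ : SimpleGraph V} (H : Hyperplane Γ) : SimpleGraph (RAAG Γ) :=
  (oneSkeleton Γ).deleteEdges (Edge.ends '' {e | e.dual = H})

/-- A halfspace: a connected component of the complement of a hyperplane, given by its
vertices. -/
@[ext]
structure Halfspace (Γ : SimpleGraph V) where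
  /-- the boundary hyperplane -/
  boundary : Hyperplane Γ
  /-- the vertices of the halfspace -/
  carrier : Set (RAAG Γ)
  /-- they form a connected component -/
  isComponent : ∃ x, carrier = {y | boundary.complement.Reachable x y}

/-! ### The action of the group by deck transformations -/

section action

variable {Γ : SimpleGraph V}

instance : MulAction (RAAG Γ) (Cube Γ) where
  smul g c := ⟨g * c.base, c.dirs, c.isClique⟩
  one_smul _ := Cube.ext (one_mul _) rfl
  mul_smul g h _ := Cube.ext (mul_assoc g h _) rfl

instance : MulAction (RAAG Γ) (Edge Γ) where
  smul g e := ⟨g * e.base, e.label⟩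
  one_smul _ := Edge.ext (one_mul _) rfl
  mul_smul g h _ := Edge.ext (mul_assoc g h _) rfl

theorem cube_smul_base (g : RAAG Γ) (c : Cube Γ) : (g • c).base = g * c.base := rfl

theorem cube_smul_dirs (g : RAAG Γ) (c : Cube Γ) : (g • c).dirs = c.dirs := rfl

theorem edge_smul_base (g : RAAG Γ) (e : Edge Γ) : (g • e).base = g * e.base := rfl

theorem edge_smul_label (g : RAAG Γ) (e : Edge Γ) : (g • e).label = e.label := rfl

theorem OppositeEdges.smul {e e' : Edge Γ} (h : OppositeEdges e e') (g : RAAG Γ) :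
    OppositeEdges (g • e) (g • e') := by
  obtain ⟨h1, w, hw, h2⟩ := h
  refine ⟨h1, w, hw, ?_⟩
  rw [edge_smul_base, edge_smul_base, h2, mul_assoc]

instance : MulAction (RAAG Γ) (Hyperplane Γ) where
  smul g := Quot.map (g • ·) fun _ _ h => h.smul g
  one_smul H := by
    induction H using Quot.ind with
    | mk e => exact congrArg (Quot.mk _) (one_smul _ e)
  mul_smul g h H := by
    induction H using Quot.ind with
    | mk e => exact congrArg (Quot.mk _) (mul_smul g h e)

theorem smul_dual (g : RAAG Γ) (e : Edge Γ) : g • e.dual = (g • e).dual := rfl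

theorem Hyperplane.Meets.smul {H K : Hyperplane Γ} (h : H.Meets K) (g : RAAG Γ) :
    (g • H).Meets (g • K) := by
  rcases h with h | ⟨x, v, w, hvw, rfl, rfl⟩
  · exact Or.inl (by rw [h])
  · exact Or.inr ⟨g * x, v, w, hvw, rfl, rfl⟩

theorem StronglySeparated.smul {H K : Hyperplane Γ} (h : StronglySeparated H K) (g : RAAG Γ) :
    StronglySeparated (g • H) (g • K) := by
  rintro ⟨L, h1, h2⟩
  refine h ⟨g⁻¹ • L, ?_, ?_⟩
  · simpa using h1.smul g⁻¹
  · simpa using h2.smul g⁻¹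

theorem ends_smul (g : RAAG Γ) (e : Edge Γ) : (g • e).ends = e.ends.map (g * ·) := by
  simp [Edge.ends, edge_smul_base, edge_smul_label, mul_assoc]

theorem ends_eq_smul {g x y : RAAG Γ} {e : Edge Γ} :
    e.ends = s(g * x, g * y) ↔ (g⁻¹ • e).ends = s(x, y) := by
  rw [ends_smul]
  constructor
  · intro h
    simp [h]
  · intro h
    have := congrArg (Sym2.map (g * ·)) h
    simpa [Sym2.map_map, Function.comp_def] using this

theorem oneSkeleton_adj_smul (g x y : RAAG Γ) (h : (oneSkeleton Γ).Adj x y) :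
    (oneSkeleton Γ).Adj (g * x) (g * y) := by
  rw [oneSkeleton, SimpleGraph.fromEdgeSet_adj] at h ⊢
  obtain ⟨⟨e, he⟩, hne⟩ := h
  refine ⟨⟨g • e, ?_⟩, by simpa using hne⟩
  rw [ends_smul, he, Sym2.map_mk]

theorem complement_adj_smul {H : Hyperplane Γ} (g x y : RAAG Γ) (h : H.complement.Adj x y) :
    (g • H).complement.Adj (g * x) (g * y) := by
  rw [Hyperplane.complement, SimpleGraph.deleteEdges_adj] at h ⊢
  refine ⟨oneSkeleton_adj_smul g x y h.1, ?_⟩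
  rintro ⟨e, he, hxy⟩
  refine h.2 ⟨g⁻¹ • e, ?_, ends_eq_smul.1 hxy⟩
  change (g⁻¹ • e).dual = H
  rw [← smul_dual, show e.dual = g • H from he, inv_smul_smul]

theorem complement_reachable_smul {H : Hyperplane Γ} (g : RAAG Γ) {x y : RAAG Γ}
    (h : H.complement.Reachable x y) : (g • H).complement.Reachable (g * x) (g * y) :=
  h.map ⟨fun z => g * z, fun {a b} hab => complement_adj_smul g a b hab⟩

instance : SMul (RAAG Γ) (Halfspace Γ) where
  smul g h := ⟨g • h.boundary, g • h.carrier, by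
    obtain ⟨x, hx⟩ := h.isComponent
    refine ⟨g * x, ?_⟩
    ext y
    rw [Set.mem_smul_set_iff_inv_smul_mem, hx]
    constructor
    · intro hy
      simpa using complement_reachable_smul g hy
    · intro hy
      simpa using complement_reachable_smul g⁻¹ hy⟩

theorem smul_boundary (g : RAAG Γ) (h : Halfspace Γ) :
    (g • h).boundary = g • h.boundary := rfl

theorem smul_carrier (g : RAAG Γ) (h : Halfspace Γ) :
    (g • h).carrier = g • h.carrier := rfl

instance : MulAction (RAAG Γ) (Halfspace Γ) where
  one_smul _ := Halfspace.ext (one_smul _ _) (one_smul _ _)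
  mul_smul _ _ _ := Halfspace.ext (mul_smul _ _ _) (mul_smul _ _ _)

theorem IsFacet.smul {c c' : Cube Γ} (h : IsFacet c c') (g : RAAG Γ) :
    IsFacet (g • c) (g • c') := by
  obtain ⟨v, hv, hd, hb⟩ := h
  refine ⟨v, hv, hd, ?_⟩
  simp only [cube_smul_base]
  rcases hb with hb | hb
  · exact Or.inl (by rw [hb])
  · exact Or.inr (by rw [hb, mul_assoc])

theorem component_smul_subset {Λ : Set V} (g : RAAG Γ) (c c' : Cube Γ)
    (h : c' ∈ component (covering Γ ⁻¹' salvettiSub Γ Λ) c) :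
    g • c' ∈ component (covering Γ ⁻¹' salvettiSub Γ Λ) (g • c) := by
  refine Relation.ReflTransGen.lift (g • · : Cube Γ → Cube Γ) ?_ _ _ h
  rintro a b ⟨ha, hb, hab⟩
  exact ⟨ha, hb, hab.imp (fun h => h.smul g) (fun h => h.smul g)⟩

theorem IsStandardOfType.smul {Λ : Set V} {Y : Set (Cube Γ)} (h : IsStandardOfType Γ Λ Y)
    (g : RAAG Γ) : IsStandardOfType Γ Λ (g • Y) := by
  obtain ⟨c, hc, rfl⟩ := h
  refine ⟨g • c, hc, ?_⟩
  ext c'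
  rw [Set.mem_smul_set_iff_inv_smul_mem]
  constructor
  · intro h
    simpa using component_smul_subset g _ _ h
  · intro h
    simpa using component_smul_subset g⁻¹ _ _ h

instance : MulAction (RAAG Γ) (StandardInJoin Γ) where
  smul g Y := ⟨g • Y.1, Y.2.1.imp fun _ h => h.smul g, by
    obtain ⟨Z, ⟨Λ, hΛ, hZ⟩, hYZ⟩ := Y.2.2
    exact ⟨g • Z, ⟨Λ, hΛ, hZ.smul g⟩, Set.smul_set_mono hYZ⟩⟩
  one_smul _ := Subtype.ext (one_smul _ _)
  mul_smul _ _ _ := Subtype.ext (mul_smul _ _ _)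

end action

/-! ### The Roller boundary -/

open Classical in
/-- The map that sends a vertex `x` to the indicator of the set of halfspaces containing `x`. The
space `Halfspace Γ → Bool` carries the product topology. -/
noncomputable def vertexEmbedding (Γ : SimpleGraph V) (x : RAAG Γ) : Halfspace Γ → Bool :=
  fun h => decide (x ∈ h.carrier)

/-- The Roller boundary: the complement of the vertex set in its closure. -/
def RollerBoundary (Γ : SimpleGraph V) : Type u :=
  {ξ : Halfspace Γ → Bool //
    ξ ∈ closure (Set.range (vertexEmbedding Γ)) \ Set.range (vertexEmbedding Γ)}

instance (Γ : SimpleGraph V) : TopologicalSpace (RollerBoundary Γ) :=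
  inferInstanceAs (TopologicalSpace {ξ : Halfspace Γ → Bool //
    ξ ∈ closure (Set.range (vertexEmbedding Γ)) \ Set.range (vertexEmbedding Γ)})

instance (Γ : SimpleGraph V) : MeasurableSpace (RollerBoundary Γ) := borel _

instance (Γ : SimpleGraph V) : BorelSpace (RollerBoundary Γ) := ⟨rfl⟩

/-- The set of halfspaces selected by a boundary point. -/
def RollerBoundary.halfspaces {Γ : SimpleGraph V} (ξ : RollerBoundary Γ) : Set (Halfspace Γ) :=
  {h | ξ.1 h = true}

/-- The regular points of the Roller boundary. -/
def regularPoints (Γ : SimpleGraph V) : Set (RollerBoundary Γ) :=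
  {ξ | ∀ h₁ ∈ ξ.halfspaces, ∀ h₂ ∈ ξ.halfspaces, ∃ k ∈ ξ.halfspaces,
    k.carrier ⊆ h₁.carrier ∩ h₂.carrier ∧
    StronglySeparated k.boundary h₁.boundary ∧ StronglySeparated k.boundary h₂.boundary}

section boundaryAction

variable {Γ : SimpleGraph V}

/-- Translation of an indicator function on the set of halfspaces. -/
def translate (g : RAAG Γ) (ξ : Halfspace Γ → Bool) : Halfspace Γ → Bool := fun h => ξ (g⁻¹ • h)

theorem translate_vertexEmbedding (g x : RAAG Γ) :
    translate g (vertexEmbedding Γ x) = vertexEmbedding Γ (g * x) := by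
  funext h
  simp [translate, vertexEmbedding, smul_carrier, Set.mem_smul_set_iff_inv_smul_mem]

theorem translate_translate (g h : RAAG Γ) (ξ : Halfspace Γ → Bool) :
    translate g (translate h ξ) = translate (g * h) ξ := by
  funext k
  simp [translate, mul_smul]

theorem translate_one (ξ : Halfspace Γ → Bool) : translate 1 ξ = ξ := by
  funext k
  simp [translate]

theorem translate_mem (g : RAAG Γ) {ξ : Halfspace Γ → Bool}
    (h : ξ ∈ closure (Set.range (vertexEmbedding Γ)) \ Set.range (vertexEmbedding Γ)) :
    translate g ξ ∈
      closure (Set.range (vertexEmbedding Γ)) \ Set.range (vertexEmbedding Γ) := by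
  constructor
  · refine map_mem_closure (f := translate g) (continuous_pi fun k => continuous_apply _) h.1 ?_
    rintro _ ⟨x, rfl⟩
    exact ⟨g * x, (translate_vertexEmbedding g x).symm⟩
  · rintro ⟨x, hx⟩
    refine h.2 ⟨g⁻¹ * x, ?_⟩
    rw [← translate_vertexEmbedding, hx, translate_translate, inv_mul_cancel, translate_one]

instance : MulAction (RAAG Γ) (RollerBoundary Γ) where
  smul g ξ := ⟨translate g ξ.1, translate_mem g ξ.2⟩
  one_smul _ := Subtype.ext (translate_one _)
  mul_smul g h _ := Subtype.ext (translate_translate g h _).symm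

theorem mem_halfspaces_smul {g : RAAG Γ} {ξ : RollerBoundary Γ} {h : Halfspace Γ} :
    h ∈ (g • ξ).halfspaces ↔ g⁻¹ • h ∈ ξ.halfspaces := Iff.rfl

theorem regularPoints_smul (g : RAAG Γ) {ξ : RollerBoundary Γ} (hξ : ξ ∈ regularPoints Γ) :
    g • ξ ∈ regularPoints Γ := by
  intro h₁ hh₁ h₂ hh₂
  obtain ⟨k, hk, hsub, h1, h2⟩ := hξ _ (mem_halfspaces_smul.1 hh₁) _ (mem_halfspaces_smul.1 hh₂)
  refine ⟨g • k, mem_halfspaces_smul.2 (by simpa using hk), ?_, ?_, ?_⟩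
  · have := Set.smul_set_mono (a := g) hsub
    simpa [Set.smul_set_inter, smul_carrier] using this
  · simpa [smul_boundary] using h1.smul g
  · simpa [smul_boundary] using h2.smul g

end boundaryAction

/-- The space of non-regular points, a subspace of the Roller boundary. -/
abbrev NonRegular (Γ : SimpleGraph V) : Type u := {ξ : RollerBoundary Γ // ξ ∉ regularPoints Γ}

instance (Γ : SimpleGraph V) : MulAction (RAAG Γ) (NonRegular Γ) where
  smul g ξ := ⟨g • ξ.1, fun h => ξ.2 (by simpa using regularPoints_smul g⁻¹ h)⟩
  one_smul _ := Subtype.ext (one_smul _ _)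
  mul_smul _ _ _ := Subtype.ext (mul_smul _ _ _)

/-! ### Combinatorial geodesic rays -/

/-- `r` is (the sequence of vertices of) a geodesic ray in the 1-skeleton. -/
def IsGeodesicRay (Γ : SimpleGraph V) (r : ℕ → RAAG Γ) : Prop :=
  ∀ m n, (oneSkeleton Γ).dist (r m) (r (m + n)) = n

/-- The ray `r` represents the boundary point `ξ`: the halfspaces selected by `ξ` are those which
contain `r` up to a finite segment. -/
def Represents {Γ : SimpleGraph V} (r : ℕ → RAAG Γ) (ξ : RollerBoundary Γ) : Prop :=
  ∀ h : Halfspace Γ, h ∈ ξ.halfspaces ↔ ∃ N, ∀ n ≥ N, r n ∈ h.carrier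

/-- The subcomplex `Y` virtually contains `r`: it contains all the vertices and edges of `r` up to a
finite segment. -/
def VirtuallyContains {Γ : SimpleGraph V} (Y : Set (Cube Γ)) (r : ℕ → RAAG Γ) : Prop :=
  ∃ N, ∀ n ≥ N, vertexCube Γ (r n) ∈ Y ∧
    ∀ e : Edge Γ, e.ends = s(r n, r (n + 1)) → e.toCube ∈ Y

/-- For every combinatorial geodesic ray `r` representing `ξ`, the subcomplex `Y` is the smallest
standard subcomplex that virtually contains `r`. -/
def IsSmallestFor {Γ : SimpleGraph V} (Y : Set (Cube Γ)) (ξ : RollerBoundary Γ) : Prop :=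
  ∀ r : ℕ → RAAG Γ, IsGeodesicRay Γ r → Represents r ξ →
    IsLeast {Z : Set (Cube Γ) | IsStandard Γ Z ∧ VirtuallyContains Z r} Y

end Salvetti

namespace Salvetti

universe u

variable {V : Type u} {Γ : SimpleGraph V}

/-! ### Generators and special subgroups -/

/-! Every boundary point `ξ` is the limit of a geodesic ray `r` (`exists_ray`). Let `Λ` be the set
of labels occurring infinitely often along `r`. Past some vertex only these labels occur, so the
tail of `r` stays in one coset of the subgroup generated by `Λ`. Any standard subcomplex virtually
containing `r` has all of `Λ` in its type, so that coset spans the smallest one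
(`isLeast_standard`). Virtual containment can be read off from the halfspaces selected by `ξ`
(`virtuallyContains_iff`). Hence the answer does not depend on the ray, and it is given by countably
many clopen conditions on `ξ`. This yields uniqueness, equivariance and measurability.

The geometric core is that `ξ` is regular unless `Λ` lies in a join
(`exists_isJoin_of_not_regular`). If `Λ` is not a join, its complement graph is connected.
Consecutive non-adjacent labels along the ray give nested halfspaces, so a walk in the complement
graph through all of `Λ` gives a nested chain. A hyperplane crossing both ends of the chain crosses
every member, so its label is adjacent to all of `Λ`; then `Λ` together with this label would be a
join. Thus the ends are strongly separated. Repeating this gives an infinite chain, which forces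
regularity (`mem_regularPoints_of_chain`).

The hyperplane geometry is derived from the presentation. A homomorphism to a semidirect product
records the parity of crossings of each hyperplane, and this separates the two halfspaces
(`reachable_iff`). -/

theorem commute_gen {v w : V} (h : Γ.Adj v w) : Commute (gen Γ v) (gen Γ w) := by
  have : (PresentedGroup.mk (relators Γ)) (FreeGroup.of v * FreeGroup.of w *
      (FreeGroup.of v)⁻¹ * (FreeGroup.of w)⁻¹) = 1 :=
    PresentedGroup.one_of_mem ⟨v, w, h, rfl⟩
  have h' : gen Γ v * gen Γ w * (gen Γ v)⁻¹ * (gen Γ w)⁻¹ = 1 := by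
    simp only [map_mul, map_inv] at this
    exact this
  rwa [mul_inv_eq_one, mul_inv_eq_iff_eq_mul] at h'

/-- The special subgroup generated by a set of vertices of `Γ`. -/
def special (Γ : SimpleGraph V) (Λ : Set V) : Subgroup (RAAG Γ) :=
  Subgroup.closure (gen Γ '' Λ)

theorem gen_mem_special {Λ : Set V} {v : V} (hv : v ∈ Λ) : gen Γ v ∈ special Γ Λ :=
  Subgroup.subset_closure ⟨v, hv, rfl⟩

theorem special_mono {Λ Λ' : Set V} (h : Λ ⊆ Λ') : special Γ Λ ≤ special Γ Λ' :=
  Subgroup.closure_mono (Set.image_mono h)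

theorem special_univ : special Γ Set.univ = ⊤ := by
  rw [special, Set.image_univ]
  exact PresentedGroup.closure_range_of _

theorem special_induction {Λ : Set V} {p : RAAG Γ → Prop} (one : p 1)
    (mul : ∀ g ∈ special Γ Λ, ∀ v ∈ Λ, p g → p (g * gen Γ v))
    (mul_inv : ∀ g ∈ special Γ Λ, ∀ v ∈ Λ, p g → p (g * (gen Γ v)⁻¹))
    {g : RAAG Γ} (hg : g ∈ special Γ Λ) : p g := by
  refine Subgroup.closure_induction_right (p := fun g _ => p g) one ?_ ?_ hg
  · rintro g hg _ ⟨v, hv, rfl⟩ h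
    exact mul g hg v hv h
  · rintro g hg _ ⟨v, hv, rfl⟩ h
    exact mul_inv g hg v hv h

theorem commute_of_mem_special_link {v : V} {u : RAAG Γ} (hu : u ∈ special Γ (Γ.neighborSet v)) :
    Commute (gen Γ v) u := by
  refine special_induction (Commute.one_right _) ?_ ?_ hu
  · exact fun g _ w hw h => h.mul_right (commute_gen hw)
  · exact fun g _ w hw h => h.mul_right (commute_gen hw).inv_right

/-! ### Hyperplanes and their labels -/

/-- The common label of the edges dual to a hyperplane. -/
def Hyperplane.label (H : Hyperplane Γ) : V := Quot.lift Edge.label (fun _ _ h => h.1.symm) H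

@[simp] theorem label_dual (e : Edge Γ) : e.dual.label = e.label := rfl

theorem dual_mul_gen {g : RAAG Γ} {v w : V} (h : Γ.Adj v w) :
    Edge.dual ⟨g * gen Γ w, v⟩ = Edge.dual ⟨g, v⟩ :=
  (Quot.sound ⟨rfl, w, h, rfl⟩).symm

theorem dual_mul_special {g u : RAAG Γ} {v : V} (hu : u ∈ special Γ (Γ.neighborSet v)) :
    Edge.dual ⟨g * u, v⟩ = Edge.dual ⟨g, v⟩ := by
  refine special_induction (p := fun u => Edge.dual ⟨g * u, v⟩ = Edge.dual ⟨g, v⟩) (by simp)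
    ?_ ?_ hu
  · intro k _ w hw h
    rw [← h, ← mul_assoc, dual_mul_gen hw]
  · intro k _ w hw h
    rw [← h, ← mul_assoc, ← dual_mul_gen hw, inv_mul_cancel_right]

/-- Passing to the opposite edge of a square multiplies the base on the right by a generator in the
link of the label. With `dual_mul_special`, this identifies the edges dual to a hyperplane with a
coset of the link subgroup. -/
theorem mem_special_of_dual_eq {e e' : Edge Γ} (h : e.dual = e'.dual) :
    e.base⁻¹ * e'.base ∈ special Γ (Γ.neighborSet e.label) := by
  have h' := Quot.eqvGen_exact h
  clear h
  induction h' with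
  | rel e e' h =>
    obtain ⟨-, w, hw, hb⟩ := h
    rw [hb, inv_mul_cancel_left]
    exact gen_mem_special hw
  | refl e => simp
  | symm e e' h ih =>
    have hl : e.label = e'.label := congrArg Hyperplane.label (Quot.eqvGen_sound h)
    rw [← hl]
    simpa using inv_mem ih
  | trans e e' e'' h h' ih ih' =>
    have hl : e.label = e'.label := congrArg Hyperplane.label (Quot.eqvGen_sound h)
    have := mul_mem ih (hl ▸ ih')
    simpa [mul_assoc] using this

/-! ### The two sides of a hyperplane -/

open Classical in
/-- The value of `sideHom` on a generator. -/
noncomputable def sideGen (Γ : SimpleGraph V) (v : V) :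
    (Hyperplane Γ → Multiplicative (ZMod 2)) ⋊[mulAutArrow] RAAG Γ :=
  ⟨fun H => Multiplicative.ofAdd (if Edge.dual ⟨1, v⟩ = H then 1 else 0), gen Γ v⟩

open Classical in
theorem mulAutArrow_sideGen (g : RAAG Γ) (v : V) (H : Hyperplane Γ) :
    (mulAutArrow g (sideGen Γ v).left : Hyperplane Γ → Multiplicative (ZMod 2)) H =
      Multiplicative.ofAdd (if Edge.dual ⟨g, v⟩ = H then 1 else 0) := by
  change Multiplicative.ofAdd (if Edge.dual ⟨1, v⟩ = g⁻¹ • H then 1 else 0) = _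
  have : g • Edge.dual (⟨1, v⟩ : Edge Γ) = Edge.dual ⟨g, v⟩ := by
    rw [smul_dual]
    exact congrArg Edge.dual (Edge.ext (mul_one g) rfl)
  rw [← this]
  simp only [eq_inv_smul_iff]

/-- The two paths across a square cross the same two hyperplanes, since opposite edges have the same
dual. -/
theorem lift_sideGen_relators : ∀ r ∈ relators Γ, FreeGroup.lift (sideGen Γ) r = 1 := by
  rintro _ ⟨v, w, h, rfl⟩
  simp only [map_mul, map_inv, FreeGroup.lift_apply_of]
  rw [mul_inv_eq_one, mul_inv_eq_iff_eq_mul]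
  refine SemidirectProduct.ext ?_ (commute_gen h)
  funext H
  have h1 : Edge.dual ⟨gen Γ v, w⟩ = Edge.dual ⟨1, w⟩ := by
    simpa using dual_mul_gen (g := 1) h.symm
  have h2 : Edge.dual ⟨gen Γ w, v⟩ = Edge.dual ⟨1, v⟩ := by
    simpa using dual_mul_gen (g := 1) h
  have e1 := mulAutArrow_sideGen (gen Γ v) w H
  have e2 := mulAutArrow_sideGen (gen Γ w) v H
  rw [h1] at e1
  rw [h2] at e2
  rw [SemidirectProduct.mul_left, SemidirectProduct.mul_left, Pi.mul_apply, Pi.mul_apply]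
  change _ * (mulAutArrow (gen Γ v) (sideGen Γ w).left : Hyperplane Γ → Multiplicative (ZMod 2)) H
    = _ * (mulAutArrow (gen Γ w) (sideGen Γ v).left : Hyperplane Γ → Multiplicative (ZMod 2)) H
  rw [e1, e2, mul_comm]
  rfl

/-- The homomorphism whose first component records the hyperplanes that separate a vertex from the
identity. -/
noncomputable def sideHom (Γ : SimpleGraph V) :
    RAAG Γ →* (Hyperplane Γ → Multiplicative (ZMod 2)) ⋊[mulAutArrow] RAAG Γ :=
  PresentedGroup.toGroup lift_sideGen_relators

theorem sideHom_gen (v : V) : sideHom Γ (gen Γ v) = sideGen Γ v :=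
  PresentedGroup.toGroup.of _

theorem sideHom_right (g : RAAG Γ) : (sideHom Γ g).right = g := by
  have : (SemidirectProduct.rightHom).comp (sideHom Γ) = MonoidHom.id _ := by
    refine PresentedGroup.ext fun v => ?_
    change SemidirectProduct.rightHom (sideHom Γ (gen Γ v)) = gen Γ v
    rw [sideHom_gen]
    rfl
  exact DFunLike.congr_fun this g

/-- The side of the hyperplane `H` on which a vertex lies. -/
noncomputable def side (H : Hyperplane Γ) (g : RAAG Γ) : ZMod 2 :=
  Multiplicative.toAdd ((sideHom Γ g).left H)

open Classical in
theorem side_mul_gen (H : Hyperplane Γ) (g : RAAG Γ) (v : V) :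
    side H (g * gen Γ v) = side H g + if Edge.dual ⟨g, v⟩ = H then 1 else 0 := by
  rw [side, map_mul, SemidirectProduct.mul_left, sideHom_right, sideHom_gen, Pi.mul_apply,
    mulAutArrow_sideGen, toAdd_mul, toAdd_ofAdd, side]

theorem side_mul_gen_of_ne {H : Hyperplane Γ} {g : RAAG Γ} {v : V} (h : Edge.dual ⟨g, v⟩ ≠ H) :
    side H (g * gen Γ v) = side H g := by
  simp [side_mul_gen, h]

theorem side_mul_gen_dual (g : RAAG Γ) (v : V) :
    side (Edge.dual ⟨g, v⟩) g ≠ side (Edge.dual ⟨g, v⟩) (g * gen Γ v) := by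
  simp [side_mul_gen]

theorem side_eq_of_ne_of_ne {H : Hyperplane Γ} {x y z : RAAG Γ} (h : side H x ≠ side H y)
    (h' : side H x ≠ side H z) : side H y = side H z := by
  revert h h'
  generalize side H x = a
  generalize side H y = b
  generalize side H z = c
  revert a b c
  decide

theorem side_base_eq {a b : RAAG Γ} {v : V} (h : b ∈ special Γ (Γ.neighborSet v))  :
    side (Edge.dual ⟨a, v⟩) (a * b) = side (Edge.dual ⟨a, v⟩) a := by
  refine special_induction (p := fun b => side (Edge.dual ⟨a, v⟩) (a * b) =
    side (Edge.dual ⟨a, v⟩) a) (by simp) ?_ ?_ h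
  · intro g _ w hw ih
    rw [← ih, ← mul_assoc, side_mul_gen_of_ne]
    exact fun hh => Γ.ne_of_adj hw (congrArg Hyperplane.label hh).symm
  · intro g _ w hw ih
    rw [← ih, ← mul_assoc, ← side_mul_gen_of_ne (g := a * g * (gen Γ w)⁻¹) (v := w),
      inv_mul_cancel_right]
    exact fun hh => Γ.ne_of_adj hw (congrArg Hyperplane.label hh).symm

theorem gen_ne_one (v : V) : gen Γ v ≠ 1 := fun h =>
  side_mul_gen_dual (1 : RAAG Γ) v (by rw [h, mul_one])

/-! ### The 1-skeleton -/

theorem adj_iff {x y : RAAG Γ} : (oneSkeleton Γ).Adj x y ↔ ∃ e : Edge Γ, e.ends = s(x, y) := by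
  rw [oneSkeleton, SimpleGraph.fromEdgeSet_adj]
  refine ⟨fun h => h.1, fun h => ⟨h, ?_⟩⟩
  rintro rfl
  obtain ⟨e, he⟩ := h
  rw [Edge.ends, Sym2.eq_iff] at he
  have : e.base = e.base * gen Γ e.label := by
    rcases he with ⟨h1, h2⟩ | ⟨h1, h2⟩ <;> exact h1.trans h2.symm
  exact gen_ne_one e.label (left_eq_mul.1 this)

theorem ends_eq_iff {e : Edge Γ} {x y : RAAG Γ} : e.ends = s(x, y) ↔
    (x = e.base ∧ y = e.base * gen Γ e.label) ∨ (y = e.base ∧ x = e.base * gen Γ e.label) := by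
  rw [Edge.ends, Sym2.eq_iff, eq_comm (a := e.base), eq_comm (a := e.base * _),
    eq_comm (a := e.base), eq_comm (a := e.base * _)]

theorem ends_swap {e : Edge Γ} {x y : RAAG Γ} (h : e.ends = s(x, y)) : e.ends = s(y, x) := by
  rw [h, Sym2.eq_swap]

theorem ends_mul_gen (g : RAAG Γ) (v : V) : Edge.ends ⟨g, v⟩ = s(g, g * gen Γ v) := rfl

theorem side_ne_of_ends {e : Edge Γ} {x y : RAAG Γ} (h : e.ends = s(x, y)) :
    side e.dual x ≠ side e.dual y := by
  rcases ends_eq_iff.1 h with ⟨rfl, rfl⟩ | ⟨rfl, rfl⟩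
  · exact side_mul_gen_dual e.base e.label
  · exact (side_mul_gen_dual e.base e.label).symm

theorem dual_eq_of_side_ne {e : Edge Γ} {x y : RAAG Γ} {H : Hyperplane Γ} (h : e.ends = s(x, y))
    (hs : side H x ≠ side H y) : e.dual = H := by
  by_contra hne
  rcases ends_eq_iff.1 h with ⟨rfl, rfl⟩ | ⟨rfl, rfl⟩
  · exact hs (side_mul_gen_of_ne hne).symm
  · exact hs (side_mul_gen_of_ne hne)

theorem complement_adj_iff {H : Hyperplane Γ} {x y : RAAG Γ} :
    H.complement.Adj x y ↔ (oneSkeleton Γ).Adj x y ∧ side H x = side H y := by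
  rw [Hyperplane.complement, SimpleGraph.deleteEdges_adj]
  refine and_congr_right fun h => ⟨fun h' => ?_, ?_⟩
  · by_contra hs
    obtain ⟨e, he⟩ := adj_iff.1 h
    exact h' ⟨e, dual_eq_of_side_ne he hs, he⟩
  · rintro hs ⟨e, rfl, he⟩
    exact side_ne_of_ends he hs

theorem adj_mul_gen (g : RAAG Γ) (v : V) : (oneSkeleton Γ).Adj g (g * gen Γ v) :=
  adj_iff.2 ⟨⟨g, v⟩, rfl⟩

theorem adj_mul_gen_inv (g : RAAG Γ) (v : V) : (oneSkeleton Γ).Adj g (g * (gen Γ v)⁻¹) := by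
  simpa using (adj_mul_gen (g * (gen Γ v)⁻¹) v).symm

theorem reachable_oneSkeleton (x y : RAAG Γ) : (oneSkeleton Γ).Reachable x y := by
  have key : ∀ g, g ∈ special Γ Set.univ → (oneSkeleton Γ).Reachable x (x * g) := by
    intro g hg
    refine special_induction (p := fun g => (oneSkeleton Γ).Reachable x (x * g)) (by simp)
      ?_ ?_ hg
    · intro g _ v _ h
      rw [← mul_assoc]
      exact h.trans (adj_mul_gen _ v).reachable
    · intro g _ v _ h
      rw [← mul_assoc]
      exact h.trans (adj_mul_gen_inv _ v).reachable
  have := key (x⁻¹ * y) (by simp [special_univ])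
  rwa [mul_inv_cancel_left] at this

theorem connected_oneSkeleton : (oneSkeleton Γ).Connected :=
  ⟨fun x y => reachable_oneSkeleton x y⟩

theorem reachable_mul_special {H : Hyperplane Γ} {a b : RAAG Γ} {v : V} (hH : v = H.label)
    (hb : b ∈ special Γ (Γ.neighborSet v)) : H.complement.Reachable a (a * b) := by
  have aux : ∀ (g : RAAG Γ), ∀ w ∈ Γ.neighborSet v, H.complement.Adj g (g * gen Γ w) := by
    intro g w hw
    refine complement_adj_iff.2 ⟨adj_mul_gen _ w, (side_mul_gen_of_ne fun hh => ?_).symm⟩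
    exact Γ.ne_of_adj hw (hH.trans (congrArg Hyperplane.label hh).symm)
  refine special_induction (p := fun b => H.complement.Reachable a (a * b)) (by simp) ?_ ?_ hb
  · intro g _ w hw h
    rw [← mul_assoc]
    exact h.trans (aux _ w hw).reachable
  · intro g _ w hw h
    rw [← mul_assoc]
    refine h.trans (SimpleGraph.Adj.reachable ?_)
    simpa using (aux (a * g * (gen Γ w)⁻¹) w hw).symm

theorem side_eq_of_reachable {H : Hyperplane Γ} {x y : RAAG Γ} (h : H.complement.Reachable x y) :
    side H x = side H y := by
  obtain ⟨p⟩ := h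
  induction p with
  | nil => rfl
  | cons h _ ih => exact (complement_adj_iff.1 h).2.trans ih

/-- This is the bound of two components. Along a path to `e`, a step that changes sides of `H` is
itself dual to `H`, so it is parallel to `e` along the link coset, which does not cross `H`. -/
theorem reachable_carrier {H : Hyperplane Γ} {e : Edge Γ} (he : e.dual = H) (x : RAAG Γ) :
    H.complement.Reachable x e.base ∨ H.complement.Reachable x (e.base * gen Γ e.label) := by
  have step : ∀ x y, (oneSkeleton Γ).Adj x y →
      (H.complement.Reachable y e.base ∨ H.complement.Reachable y (e.base * gen Γ e.label)) →
      (H.complement.Reachable x e.base ∨ H.complement.Reachable x (e.base * gen Γ e.label)) := by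
    intro x y h ih
    by_cases hs : side H x = side H y
    · have hr := (complement_adj_iff.2 ⟨h, hs⟩).reachable
      exact ih.imp hr.trans hr.trans
    · obtain ⟨e', he'⟩ := adj_iff.1 h
      have hd := dual_eq_of_side_ne he' hs
      have hu := mem_special_of_dual_eq (he.trans hd.symm)
      have hl : e.label = e'.label := congrArg Hyperplane.label (he.trans hd.symm)
      have hH : e.label = H.label := congrArg Hyperplane.label he
      rcases ends_eq_iff.1 he' with ⟨rfl, -⟩ | ⟨-, rfl⟩
      · left
        simpa using (reachable_mul_special (a := e.base) hH hu).symm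
      · right
        have := (reachable_mul_special (a := e.base * gen Γ e.label) hH hu).symm
        rw [mul_assoc, (commute_of_mem_special_link hu).eq, ← mul_assoc, mul_inv_cancel_left,
          hl] at this
        rwa [hl]
  have walk : ∀ z, (oneSkeleton Γ).Walk x z → z = e.base →
      (H.complement.Reachable x e.base ∨ H.complement.Reachable x (e.base * gen Γ e.label)) := by
    intro z p hz
    induction p with
    | nil => exact Or.inl (hz ▸ SimpleGraph.Reachable.refl _)
    | cons h _ ih => exact step _ _ h (ih hz)
  obtain ⟨p⟩ := reachable_oneSkeleton x e.base
  exact walk _ p rfl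

/-- There are at most two components, and parity tells the two ends of a dual edge apart. -/
theorem reachable_iff {H : Hyperplane Γ} {x y : RAAG Γ} :
    H.complement.Reachable x y ↔ side H x = side H y := by
  refine ⟨side_eq_of_reachable, fun h => ?_⟩
  obtain ⟨e, rfl⟩ := Quot.exists_rep H
  have hne := side_mul_gen_dual e.base e.label
  rcases reachable_carrier (e := e) rfl x with hx | hx <;>
    rcases reachable_carrier (e := e) rfl y with hy | hy
  · exact hx.trans hy.symm
  · exact absurd (((side_eq_of_reachable hx).symm.trans h).trans (side_eq_of_reachable hy)) hne
  · exact absurd (((side_eq_of_reachable hy).symm.trans h.symm).trans (side_eq_of_reachable hx)) hne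
  · exact hx.trans hy.symm

/-! ### Halfspaces -/

/-- The halfspace bounded by `H` that contains `x`. -/
def halfspaceAt (H : Hyperplane Γ) (x : RAAG Γ) : Halfspace Γ :=
  ⟨H, {y | H.complement.Reachable x y}, x, rfl⟩

theorem mem_halfspaceAt {H : Hyperplane Γ} {x y : RAAG Γ} :
    y ∈ (halfspaceAt H x).carrier ↔ side H x = side H y := reachable_iff

theorem eq_halfspaceAt {h : Halfspace Γ} {x : RAAG Γ} (hx : x ∈ h.carrier) :
    h = halfspaceAt h.boundary x := by
  obtain ⟨y, hy⟩ := h.isComponent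
  refine Halfspace.ext rfl ?_
  rw [hy] at hx ⊢
  ext z
  exact ⟨fun hz => hx.symm.trans hz, fun hz => hx.trans hz⟩

theorem halfspaceAt_congr {H : Hyperplane Γ} {x y : RAAG Γ} (h : side H x = side H y) :
    halfspaceAt H x = halfspaceAt H y :=
  eq_halfspaceAt (h := halfspaceAt H x) (mem_halfspaceAt.2 h)

theorem Halfspace.nonempty (h : Halfspace Γ) : h.carrier.Nonempty := by
  obtain ⟨x, hx⟩ := h.isComponent
  exact ⟨x, hx ▸ SimpleGraph.Reachable.refl x⟩

theorem mem_carrier_iff {h : Halfspace Γ} {x y : RAAG Γ} (hx : x ∈ h.carrier) :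
    y ∈ h.carrier ↔ side h.boundary x = side h.boundary y := by
  rw [eq_halfspaceAt hx]
  exact mem_halfspaceAt

theorem exists_side_ne (H : Hyperplane Γ) (x : RAAG Γ) : ∃ y, side H x ≠ side H y := by
  obtain ⟨e, rfl⟩ := Quot.exists_rep H
  by_contra! h
  exact side_mul_gen_dual e.base e.label ((h _).symm.trans (h _))

/-! ### The path metric -/

theorem dist_triangle (x y z : RAAG Γ) : (oneSkeleton Γ).dist x z ≤
    (oneSkeleton Γ).dist x y + (oneSkeleton Γ).dist y z :=
  connected_oneSkeleton.dist_triangle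

theorem dist_mul_left_le (g x y : RAAG Γ) :
    (oneSkeleton Γ).dist (g * x) (g * y) ≤ (oneSkeleton Γ).dist x y := by
  obtain ⟨p, hp⟩ := connected_oneSkeleton.exists_walk_length_eq_dist x y
  let f : oneSkeleton Γ →g oneSkeleton Γ :=
    ⟨fun z => g * z, fun {a b} hab => oneSkeleton_adj_smul g a b hab⟩
  have := SimpleGraph.dist_le (p.map f)
  rwa [SimpleGraph.Walk.length_map, hp] at this

theorem dist_mul_left (g x y : RAAG Γ) :
    (oneSkeleton Γ).dist (g * x) (g * y) = (oneSkeleton Γ).dist x y := by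
  refine le_antisymm (dist_mul_left_le g x y) ?_
  simpa using dist_mul_left_le g⁻¹ (g * x) (g * y)

theorem dist_eq_of_inv_mul_eq {x y x' y' : RAAG Γ} (h : x⁻¹ * y = x'⁻¹ * y') :
    (oneSkeleton Γ).dist x y = (oneSkeleton Γ).dist x' y' := by
  rw [← dist_mul_left x⁻¹, ← dist_mul_left x'⁻¹ x', h, inv_mul_cancel, inv_mul_cancel]

theorem exists_adj_dist {x y : RAAG Γ} (h : x ≠ y) :
    ∃ z, (oneSkeleton Γ).Adj x z ∧ (oneSkeleton Γ).dist z y + 1 = (oneSkeleton Γ).dist x y := by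
  obtain ⟨p, hp⟩ := connected_oneSkeleton.exists_walk_length_eq_dist x y
  cases p with
  | nil => exact absurd rfl h
  | @cons _ z _ hz q =>
    refine ⟨z, hz, ?_⟩
    have h1 := SimpleGraph.dist_le q
    have h2 := dist_triangle x z y
    rw [SimpleGraph.dist_eq_one_iff_adj.2 hz] at h2
    rw [SimpleGraph.Walk.length_cons] at hp
    omega

/-- Edges dual to the same hyperplane are parallel. -/
theorem inv_mul_eq_of_dual_eq {e e' : Edge Γ} (h : e.dual = e'.dual) {x x' y y' : RAAG Γ}
    (he : e.ends = s(x, x')) (he' : e'.ends = s(y, y')) (hs : side e.dual x = side e.dual y) :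
    x⁻¹ * y = x'⁻¹ * y' := by
  have hu := mem_special_of_dual_eq h
  have hl : e.label = e'.label := congrArg Hyperplane.label h
  have hb := side_base_eq (a := e.base) hu
  rw [mul_inv_cancel_left] at hb
  change side e.dual e'.base = side e.dual e.base at hb
  have key : e.base⁻¹ * e'.base =
      (e.base * gen Γ e.label)⁻¹ * (e'.base * gen Γ e'.label) := by
    rw [← hl, mul_inv_rev, mul_assoc, ← mul_assoc e.base⁻¹,
      ← (commute_of_mem_special_link hu).eq, inv_mul_cancel_left]
  have hne := side_mul_gen_dual e.base e.label
  have hne' := side_mul_gen_dual e'.base e'.label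
  change side e.dual _ ≠ side e.dual _ at hne
  change side e'.dual _ ≠ side e'.dual _ at hne'
  rw [← h] at hne'
  -- The link element commutes with the label, which settles the two matching orientations; `hs`
  -- excludes the mixed ones.
  rcases ends_eq_iff.1 he with ⟨rfl, rfl⟩ | ⟨rfl, rfl⟩ <;>
    rcases ends_eq_iff.1 he' with ⟨rfl, rfl⟩ | ⟨rfl, rfl⟩
  · exact key
  · exact absurd (hb.trans hs) hne'
  · exact absurd (hs.trans hb).symm hne
  · exact key.symm

/-- A geodesic between two vertices separated by `H` contains an edge dual to `H`. -/
theorem exists_crossing {H : Hyperplane Γ} {x y : RAAG Γ} (h : side H x ≠ side H y) :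
    ∃ p q, ∃ e : Edge Γ, e.ends = s(p, q) ∧ e.dual = H ∧ side H p = side H x ∧
      side H q = side H y ∧
      (oneSkeleton Γ).dist x p + 1 + (oneSkeleton Γ).dist q y ≤ (oneSkeleton Γ).dist x y := by
  induction hn : (oneSkeleton Γ).dist x y generalizing x with
  | zero =>
    rw [connected_oneSkeleton.dist_eq_zero_iff] at hn
    exact absurd (hn ▸ rfl) h
  | succ n ih =>
    obtain ⟨z, hz, hd⟩ := exists_adj_dist (x := x) (y := y) (by rintro rfl; exact h rfl)
    by_cases hs : side H x = side H z
    · obtain ⟨p, q, e, he, hH, hp, hq, hle⟩ := ih (x := z) (hs ▸ h) (by omega)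
      refine ⟨p, q, e, he, hH, hp.trans hs.symm, hq, ?_⟩
      have := dist_triangle x z p
      rw [SimpleGraph.dist_eq_one_iff_adj.2 hz] at this
      omega
    · obtain ⟨e, he⟩ := adj_iff.1 hz
      refine ⟨x, z, e, he, dual_eq_of_side_ne he hs, rfl, side_eq_of_ne_of_ne hs h, ?_⟩
      rw [SimpleGraph.dist_self]
      omega

/-- Crossing a hyperplane that separates `x` from `y` decreases the distance to `y`. -/
theorem dist_lt_of_side_ne {e : Edge Γ} {x z y : RAAG Γ} (he : e.ends = s(x, z))
    (h : side e.dual x ≠ side e.dual y) :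
    (oneSkeleton Γ).dist z y + 1 ≤ (oneSkeleton Γ).dist x y := by
  obtain ⟨p, q, e', he', hd, hp, -, hle⟩ := exists_crossing h
  -- The edge from `x` to `z` is parallel to the crossing edge from `p` to `q`. So `z` is as far
  -- from `q` as `x` is from `p`, and starting at `z` saves the crossing.
  have h1 := dist_eq_of_inv_mul_eq (inv_mul_eq_of_dual_eq hd.symm he he' hp.symm)
  have h2 := dist_triangle z q y
  omega

theorem side_ne_of_dist_lt {e : Edge Γ} {x z y : RAAG Γ} (he : e.ends = s(x, z))
    (h : (oneSkeleton Γ).dist z y < (oneSkeleton Γ).dist x y) :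
    side e.dual x ≠ side e.dual y := by
  intro hs
  have := dist_lt_of_side_ne (ends_swap he) (y := y) fun h' =>
    side_ne_of_ends he (hs.trans h'.symm)
  omega

theorem finite_separating (x y : RAAG Γ) : {H : Hyperplane Γ | side H x ≠ side H y}.Finite := by
  induction hn : (oneSkeleton Γ).dist x y generalizing x with
  | zero =>
    rw [connected_oneSkeleton.dist_eq_zero_iff] at hn
    simp [hn]
  | succ n ih =>
    obtain ⟨z, hz, hd⟩ := exists_adj_dist (x := x) (y := y) (by rintro rfl; simp at hn)
    obtain ⟨e, he⟩ := adj_iff.1 hz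
    refine ((ih z (by omega)).insert e.dual).subset fun H hH => ?_
    by_cases hs : side H x = side H z
    · exact Or.inr fun h' => hH (hs.trans h')
    · exact Or.inl (dual_eq_of_side_ne he hs).symm

/-- If all the hyperplanes separating `x` from `y` have their labels in `Λ`, then `x` and `y` are in
the same coset of the special subgroup of `Λ`. -/
theorem mem_special_of_labels {Λ : Set V} {x y : RAAG Γ}
    (h : ∀ H : Hyperplane Γ, side H x ≠ side H y → H.label ∈ Λ) : x⁻¹ * y ∈ special Γ Λ := by
  induction hn : (oneSkeleton Γ).dist x y generalizing x with
  | zero =>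
    rw [connected_oneSkeleton.dist_eq_zero_iff] at hn
    simp [hn]
  | succ n ih =>
    obtain ⟨z, hz, hd⟩ := exists_adj_dist (x := x) (y := y) (by rintro rfl; simp at hn)
    obtain ⟨e, he⟩ := adj_iff.1 hz
    have hxy := side_ne_of_dist_lt he (y := y) (by omega)
    have hz' : z⁻¹ * y ∈ special Γ Λ := by
      refine ih (fun H hH => ?_) (by omega)
      by_cases hs : side H x = side H z
      · exact h H (hs ▸ hH)
      · rw [← dual_eq_of_side_ne he hs]
        exact h _ hxy
    have hl : gen Γ e.label ∈ special Γ Λ := gen_mem_special (h _ hxy)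
    have hxz : x⁻¹ * z ∈ special Γ Λ := by
      rcases ends_eq_iff.1 he with ⟨rfl, rfl⟩ | ⟨rfl, rfl⟩
      · simpa using hl
      · simpa using hl
    simpa [mul_assoc] using mul_mem hxz hz'

/-- If `y` is the point of the coset `y * special Γ Λ` nearest to `x`, then no hyperplane dual to an
edge of the coset separates `x` from `y`. -/
theorem side_eq_of_nearest {Λ : Set V} {x y : RAAG Γ}
    (hy : ∀ u ∈ special Γ Λ, (oneSkeleton Γ).dist x y ≤ (oneSkeleton Γ).dist x (y * u))
    {u : RAAG Γ} (hu : u ∈ special Γ Λ) {w : V} (hw : w ∈ Λ) :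
    side (Edge.dual ⟨y * u, w⟩) x = side (Edge.dual ⟨y * u, w⟩) y := by
  by_contra hs
  set K : Hyperplane Γ := Edge.dual ⟨y * u, w⟩ with hK
  obtain ⟨p, q, e, he, hd, hp, hq, hle⟩ := exists_crossing hs
  obtain ⟨z, z', e', he', hd', hz, hzC, hzC'⟩ : ∃ z z', ∃ e' : Edge Γ, e'.ends = s(z, z') ∧
      e'.dual = K ∧ side K z = side K x ∧ y⁻¹ * z ∈ special Γ Λ ∧ y⁻¹ * z' ∈ special Γ Λ := by
    have hu' : y⁻¹ * (y * u * gen Γ w) ∈ special Γ Λ := by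
      simpa [mul_assoc] using mul_mem hu (gen_mem_special hw)
    have hne := side_mul_gen_dual (y * u) w
    by_cases hz : side K (y * u) = side K x
    · exact ⟨y * u, y * u * gen Γ w, ⟨y * u, w⟩, rfl, rfl, hz, by simpa using hu, hu'⟩
    · exact ⟨y * u * gen Γ w, y * u, ⟨y * u, w⟩, ends_swap rfl, rfl,
        side_eq_of_ne_of_ne hne hz, hu', by simpa using hu⟩
  -- Parallelism gives `p * q⁻¹ = z * z'⁻¹`. Left translation by this element sends `q` to `p` and
  -- `y` to another point of the coset, reached from `x` without crossing `K`, hence nearer than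
  -- `y`.
  have hpar := inv_mul_eq_of_dual_eq (hd.trans hd'.symm) he he'
    (by rw [hd]; exact hp.trans hz.symm)
  have h1 : p * q⁻¹ = z * z'⁻¹ := by
    rw [inv_mul_eq_iff_eq_mul] at hpar
    rw [hpar]
    group
  have hmem : y⁻¹ * (p * q⁻¹ * y) ∈ special Γ Λ := by
    have := mul_mem hzC (inv_mem hzC')
    rw [h1]
    simpa [mul_assoc] using this
  have h2 := hy _ hmem
  rw [mul_inv_cancel_left] at h2
  have h3 := dist_triangle x p (p * q⁻¹ * y)
  have h4 : (oneSkeleton Γ).dist p (p * q⁻¹ * y) = (oneSkeleton Γ).dist q y :=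
    dist_eq_of_inv_mul_eq (by group)
  omega

/-! ### Crossing hyperplanes -/

/-- Two hyperplanes cross if each side of the one meets each side of the other. -/
def Hyperplane.Crosses (H K : Hyperplane Γ) : Prop :=
  ∀ a b : ZMod 2, ∃ x, side H x = a ∧ side K x = b

theorem Hyperplane.Crosses.symm {H K : Hyperplane Γ} (h : H.Crosses K) : K.Crosses H :=
  fun a b => (h b a).imp fun _ => And.symm

theorem crosses_of_quadrants {H K : Hyperplane Γ} {x y z t : RAAG Γ}
    (hxy : side H x = side H y) (hzt : side H z = side H t) (hxz : side H x ≠ side H z)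
    (hxy' : side K x ≠ side K y) (hzt' : side K z ≠ side K t) : H.Crosses K := by
  have cover : ∀ a b c : ZMod 2, a ≠ b → c = a ∨ c = b := by decide
  intro a b
  rcases cover _ _ a hxz with rfl | rfl
  · rcases cover _ _ b hxy' with rfl | rfl
    · exact ⟨x, rfl, rfl⟩
    · exact ⟨y, hxy.symm, rfl⟩
  · rcases cover _ _ b hzt' with rfl | rfl
    · exact ⟨z, rfl, rfl⟩
    · exact ⟨t, hzt.symm, rfl⟩

/-- A hyperplane that crosses the hyperplane dual to `e` is dual to an edge of the carrier. -/
theorem Hyperplane.Crosses.exists_dual {e : Edge Γ} {K : Hyperplane Γ} (h : e.dual.Crosses K) :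
    ∃ u ∈ special Γ (Γ.neighborSet e.label), ∃ w, Γ.Adj e.label w ∧
      Edge.dual ⟨e.base * u, w⟩ = K := by
  by_contra! hno
  -- If no such edge is dual to `K`, then `K` separates no two bases of edges dual to `e.dual`.
  have hconst : ∀ u ∈ special Γ (Γ.neighborSet e.label), side K (e.base * u) = side K e.base := by
    intro u hu
    refine special_induction (p := fun u => side K (e.base * u) = side K e.base) (by simp)
      ?_ ?_ hu
    · intro g hg w hw ih
      rw [← ih, ← mul_assoc, side_mul_gen_of_ne (hno g hg w hw)]
    · intro g hg w hw ih
      have := hno (g * (gen Γ w)⁻¹) (mul_mem hg (inv_mem (gen_mem_special hw))) w hw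
      rw [← ih, ← side_mul_gen_of_ne this, ← mul_assoc, inv_mul_cancel_right]
  obtain ⟨p, hp, hpK⟩ := h 0 (side K e.base + 1)
  obtain ⟨q, hq, hqK⟩ := h 1 (side K e.base + 1)
  -- A path avoiding `K`, on the side away from `e.base`, must traverse an edge dual to `e.dual`;
  -- the base of that edge then lies on the wrong side of `K`.
  obtain ⟨P⟩ := reachable_iff.2 (hpK.trans hqK.symm)
  have hpq : side e.dual p ≠ side e.dual q := by rw [hp, hq]; exact zero_ne_one
  clear hp hq
  induction P with
  | nil => exact hpq rfl
  | @cons p p' q hadj P ih =>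
    obtain ⟨hadj', hs⟩ := complement_adj_iff.1 hadj
    by_cases hpp : side e.dual p = side e.dual p'
    · exact ih (hs ▸ hpK) hqK (hpp ▸ hpq)
    · obtain ⟨e', he'⟩ := adj_iff.1 hadj'
      have hd := dual_eq_of_side_ne he' hpp
      have hu := hconst _ (mem_special_of_dual_eq hd.symm)
      rw [mul_inv_cancel_left] at hu
      rcases ends_eq_iff.1 he' with ⟨h1, -⟩ | ⟨h1, -⟩
      · rw [← h1, hpK] at hu
        simp at hu
      · rw [← h1, ← hs, hpK] at hu
        simp at hu

theorem Hyperplane.Crosses.adj_label {H K : Hyperplane Γ} (h : H.Crosses K) :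
    Γ.Adj H.label K.label := by
  obtain ⟨e, rfl⟩ := Quot.exists_rep H
  obtain ⟨u, -, w, hw, rfl⟩ := Hyperplane.Crosses.exists_dual (e := e) h
  exact hw

theorem Hyperplane.Crosses.meets {H K : Hyperplane Γ} (h : H.Crosses K) : H.Meets K := by
  obtain ⟨e, rfl⟩ := Quot.exists_rep H
  obtain ⟨u, hu, w, hw, rfl⟩ := Hyperplane.Crosses.exists_dual (e := e) h
  exact Or.inr ⟨e.base * u, e.label, w, hw, dual_mul_special hu, rfl⟩

/-- The four vertices of the square lie in the four quadrants. -/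
theorem Hyperplane.Meets.eq_or_crosses {H K : Hyperplane Γ} (h : H.Meets K) :
    H = K ∨ H.Crosses K := by
  refine h.imp_right ?_
  rintro ⟨g, v, w, hvw, rfl, rfl⟩
  have hne := Γ.ne_of_adj hvw
  have h1 : ∀ x, side (Edge.dual ⟨g, v⟩) (x * gen Γ w) = side (Edge.dual ⟨g, v⟩) x :=
    fun x => side_mul_gen_of_ne fun hh => hne (congrArg Hyperplane.label hh).symm
  have h2 : ∀ x, side (Edge.dual ⟨g, w⟩) (x * gen Γ v) = side (Edge.dual ⟨g, w⟩) x :=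
    fun x => side_mul_gen_of_ne fun hh => hne (congrArg Hyperplane.label hh)
  refine crosses_of_quadrants (x := g) (y := g * gen Γ w) (z := g * gen Γ v)
    (t := g * gen Γ w * gen Γ v) (h1 g).symm ?_ (side_mul_gen_dual g v)
    (side_mul_gen_dual g w) ?_
  · rw [mul_assoc, ← (commute_gen hvw).eq, ← mul_assoc, h1]
  · rw [h2, h2]
    exact side_mul_gen_dual g w

/-! ### Nested halfspaces -/

theorem side_ne_of_mem_of_notMem {h : Halfspace Γ} {x y : RAAG Γ} (hx : x ∈ h.carrier)
    (hy : y ∉ h.carrier) : side h.boundary x ≠ side h.boundary y :=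
  fun hs => hy ((mem_carrier_iff hx).2 hs)

theorem side_eq_of_mem {h : Halfspace Γ} {x y : RAAG Γ} (hx : x ∈ h.carrier)
    (hy : y ∈ h.carrier) : side h.boundary x = side h.boundary y :=
  (mem_carrier_iff hx).1 hy

theorem Halfspace.exists_notMem (h : Halfspace Γ) : ∃ x, x ∉ h.carrier := by
  obtain ⟨x, hx⟩ := h.nonempty
  obtain ⟨y, hy⟩ := exists_side_ne h.boundary x
  exact ⟨y, fun hy' => hy (side_eq_of_mem hx hy')⟩

theorem side_eq_of_notMem {h : Halfspace Γ} {x y : RAAG Γ} (hx : x ∉ h.carrier)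
    (hy : y ∉ h.carrier) : side h.boundary x = side h.boundary y := by
  obtain ⟨z, hz⟩ := h.nonempty
  exact side_eq_of_ne_of_ne (side_ne_of_mem_of_notMem hz hx) (side_ne_of_mem_of_notMem hz hy)

/-- An edge dual to one boundary leaves the common carrier, so it is dual to the other boundary too.
-/
theorem boundary_eq_of_carrier_eq {h k : Halfspace Γ} (hk : h.carrier = k.carrier) :
    h.boundary = k.boundary := by
  obtain ⟨e, he⟩ := Quot.exists_rep h.boundary
  have hne := side_mul_gen_dual e.base e.label
  change side (Quot.mk _ e) _ ≠ side (Quot.mk _ e) _ at hne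
  rw [he] at hne
  have : e.dual = k.boundary := by
    refine dual_eq_of_side_ne (ends_mul_gen e.base e.label) fun hs => hne ?_
    by_cases hb : e.base ∈ k.carrier
    · exact side_eq_of_mem (hk ▸ hb) (hk ▸ (mem_carrier_iff hb).2 hs)
    · have hb' : e.base * gen Γ e.label ∉ k.carrier := fun h' => hb ((mem_carrier_iff h').2 hs.symm)
      exact side_eq_of_notMem (hk ▸ hb) (hk ▸ hb')
  exact he.symm.trans this

theorem not_crosses_of_subset {h k : Halfspace Γ} (hk : k.carrier ⊆ h.carrier) :
    ¬ k.boundary.Crosses h.boundary := by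
  intro hc
  obtain ⟨x, hx⟩ := k.nonempty
  obtain ⟨y, hy⟩ := h.exists_notMem
  obtain ⟨z, hz, hz'⟩ := hc (side k.boundary x) (side h.boundary y)
  exact side_ne_of_mem_of_notMem (hk ((mem_carrier_iff hx).2 hz.symm)) hy hz'

theorem eq_of_subset_of_boundary_eq {h k : Halfspace Γ} (hk : k.carrier ⊆ h.carrier)
    (hb : k.boundary = h.boundary) : k = h := by
  obtain ⟨x, hx⟩ := k.nonempty
  rw [eq_halfspaceAt hx, eq_halfspaceAt (hk hx), hb]

/-- Both sides of `L` have points in `k`, hence in `l`, and points outside `h`, hence outside `l`.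
-/
theorem crosses_of_subset {h k : Halfspace Γ} {l : Halfspace Γ} (hkl : k.carrier ⊆ l.carrier)
    (hlh : l.carrier ⊆ h.carrier) {L : Hyperplane Γ} (hk : L.Crosses k.boundary)
    (hh : L.Crosses h.boundary) : L.Crosses l.boundary := by
  have hin : ∀ a, ∃ x ∈ l.carrier, side L x = a := by
    intro a
    obtain ⟨y, hy⟩ := k.nonempty
    obtain ⟨x, hx, hx'⟩ := hk a (side k.boundary y)
    exact ⟨x, hkl ((mem_carrier_iff hy).2 hx'.symm), hx⟩
  have hout : ∀ a, ∃ x ∉ l.carrier, side L x = a := by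
    intro a
    obtain ⟨y, hy⟩ := h.exists_notMem
    obtain ⟨x, hx, hx'⟩ := hh a (side h.boundary y)
    exact ⟨x, fun hl => side_ne_of_mem_of_notMem (hlh hl) hy hx', hx⟩
  obtain ⟨x, hx, hxa⟩ := hin 0
  obtain ⟨y, hy, hya⟩ := hout 0
  obtain ⟨z, hz, hza⟩ := hin 1
  obtain ⟨t, ht, hta⟩ := hout 1
  exact crosses_of_quadrants (hxa.trans hya.symm) (hza.trans hta.symm)
    (by rw [hxa, hza]; exact zero_ne_one) (side_ne_of_mem_of_notMem hx hy)
    (side_ne_of_mem_of_notMem hz ht)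

/-- A hyperplane that meets the boundaries of two nested halfspaces meets the boundary of every
halfspace between them. -/
theorem meets_of_subset {h k l : Halfspace Γ} (hkl : k.carrier ⊆ l.carrier)
    (hlh : l.carrier ⊆ h.carrier) {L : Hyperplane Γ} (hk : L.Meets k.boundary)
    (hh : L.Meets h.boundary) : L.Meets l.boundary := by
  have aux : k.boundary = h.boundary → k.boundary = l.boundary := by
    intro hb
    have := eq_of_subset_of_boundary_eq (hkl.trans hlh) hb
    exact boundary_eq_of_carrier_eq (hkl.antisymm (this ▸ hlh))
  rcases hk.eq_or_crosses with rfl | hk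
  · rcases hh.eq_or_crosses with hh | hh
    · exact Or.inl (aux hh)
    · exact absurd hh (not_crosses_of_subset (hkl.trans hlh))
  · rcases hh.eq_or_crosses with rfl | hh
    · exact absurd hk.symm (not_crosses_of_subset (hkl.trans hlh))
    · exact (crosses_of_subset hkl hlh hk hh).meets

theorem stronglySeparated_of_subset {h k : Halfspace Γ} (hkh : k.carrier ⊆ h.carrier)
    (hne : k.boundary ≠ h.boundary)
    (hno : ∀ L : Hyperplane Γ, L.Crosses k.boundary → ¬ L.Crosses h.boundary) :
    StronglySeparated k.boundary h.boundary := by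
  rintro ⟨L, hk, hh⟩
  rcases hk.eq_or_crosses with rfl | hk
  · exact hh.eq_or_crosses.elim hne (not_crosses_of_subset hkh)
  · rcases hh.eq_or_crosses with rfl | hh
    · exact not_crosses_of_subset hkh hk.symm
    · exact hno L hk hh

/-! ### Points of the Roller boundary -/

/-- Basic open sets of the product topology constrain finitely many coordinates. Facts about
finitely many halfspaces thus pass from vertices to boundary points. -/
theorem exists_vertex_agreeing (ξ : RollerBoundary Γ) {F : Set (Halfspace Γ)} (hF : F.Finite) :
    ∃ z, ∀ h ∈ F, h ∈ ξ.halfspaces ↔ z ∈ h.carrier := by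
  have hopen : IsOpen (F.pi fun h => {ξ.1 h}) :=
    isOpen_set_pi hF fun h _ => isOpen_discrete _
  obtain ⟨_, hη, z, rfl⟩ := mem_closure_iff.1 ξ.2.1 _ hopen fun h _ => rfl
  refine ⟨z, fun h hh => ?_⟩
  have : vertexEmbedding Γ z h = ξ.1 h := hη h hh
  change ξ.1 h = true ↔ _
  rw [← this]
  simp [vertexEmbedding]

theorem halfspaceAt_mem_iff (ξ : RollerBoundary Γ) {H : Hyperplane Γ} {x y : RAAG Γ}
    (hxy : side H x ≠ side H y) :
    halfspaceAt H x ∈ ξ.halfspaces ↔ halfspaceAt H y ∉ ξ.halfspaces := by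
  obtain ⟨z, hz⟩ := exists_vertex_agreeing ξ
    (Set.toFinite {halfspaceAt H x, halfspaceAt H y})
  rw [hz _ (by simp), hz _ (by simp), mem_halfspaceAt, mem_halfspaceAt]
  exact ⟨fun h h' => hxy (h.trans h'.symm),
    fun h => by_contra fun h' => h (side_eq_of_ne_of_ne hxy h')⟩

theorem mem_halfspaces_of_subset (ξ : RollerBoundary Γ) {h k : Halfspace Γ}
    (hh : h ∈ ξ.halfspaces) (hk : h.carrier ⊆ k.carrier) : k ∈ ξ.halfspaces := by
  obtain ⟨z, hz⟩ := exists_vertex_agreeing ξ (Set.toFinite {h, k})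
  exact (hz k (by simp)).2 (hk ((hz h (by simp)).1 hh))

/-- Otherwise `ξ` would be the image of the vertex `x`, which the boundary excludes. -/
theorem exists_halfspaceAt_notMem (ξ : RollerBoundary Γ) (x : RAAG Γ) :
    ∃ H, halfspaceAt H x ∉ ξ.halfspaces := by
  by_contra! hall
  refine ξ.2.2 ⟨x, ?_⟩
  funext h
  have key : ξ.1 h = true ↔ x ∈ h.carrier := by
    constructor
    · intro hξ
      by_contra hx
      obtain ⟨y, hy⟩ := h.nonempty
      have hξ' : h ∈ ξ.halfspaces := hξ
      rw [eq_halfspaceAt hy] at hξ'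
      exact (halfspaceAt_mem_iff ξ (side_ne_of_mem_of_notMem hy hx)).1 hξ' (hall _)
    · intro hx
      rw [eq_halfspaceAt hx]
      exact hall _
  rw [Bool.eq_iff_iff, key]
  simp [vertexEmbedding]

/-! ### Geodesic rays -/

theorem exists_step_crossing {K : Hyperplane Γ} {r : ℕ → RAAG Γ} {m n : ℕ} (hmn : m ≤ n)
    (h : side K (r m) ≠ side K (r n)) :
    ∃ i, m ≤ i ∧ i < n ∧ side K (r i) ≠ side K (r (i + 1)) := by
  by_contra! hno
  refine h ?_
  induction n, hmn using Nat.le_induction with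
  | base => rfl
  | succ n hmn ih =>
    by_cases hs : side K (r m) = side K (r n)
    · exact hs.trans (hno n hmn n.lt_succ_self)
    · exact absurd (ih hs fun i hi hin => hno i hi (hin.trans n.lt_succ_self)) hs

theorem IsGeodesicRay.adj {r : ℕ → RAAG Γ} (hr : IsGeodesicRay Γ r)
    (n : ℕ) : (oneSkeleton Γ).Adj (r n) (r (n + 1)) :=
  SimpleGraph.dist_eq_one_iff_adj.1 (hr n 1)

/-- The step from `r i` decreases the distance to `r j`, so the hyperplane it crosses separates `r
i` from `r j`; a geodesic never crosses back. -/
theorem IsGeodesicRay.side_ne {r : ℕ → RAAG Γ} (hr : IsGeodesicRay Γ r)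
    {K : Hyperplane Γ} {i j : ℕ} (hij : i < j)
    (h : side K (r i) ≠ side K (r (i + 1))) : side K (r i) ≠ side K (r j) := by
  obtain ⟨e, he⟩ := adj_iff.1 (hr.adj i)
  obtain ⟨k, rfl⟩ := Nat.exists_eq_add_of_lt hij
  rw [← dual_eq_of_side_ne he h]
  refine side_ne_of_dist_lt he ?_
  have h1 := hr (i + 1) k
  have h2 := hr i (k + 1)
  rw [show i + 1 + k = i + k + 1 by omega] at h1
  rw [← add_assoc] at h2
  omega

theorem IsGeodesicRay.side_eq {r : ℕ → RAAG Γ} (hr : IsGeodesicRay Γ r)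
    {K : Hyperplane Γ} {m n k : ℕ} (hmn : m ≤ n) (hnk : n ≤ k)
    (h : side K (r m) ≠ side K (r n)) : side K (r n) = side K (r k) := by
  obtain ⟨i, -, hi', hs⟩ := exists_step_crossing hmn h
  exact side_eq_of_ne_of_ne (hr.side_ne hi' hs) (hr.side_ne (hi'.trans_le hnk) hs)

theorem Represents.mem_of_side_ne {r : ℕ → RAAG Γ} (hr : IsGeodesicRay Γ r)
    {ξ : RollerBoundary Γ} (hξ : Represents r ξ)
    {K : Hyperplane Γ} {m n : ℕ} (hmn : m ≤ n) (h : side K (r m) ≠ side K (r n)) :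
    halfspaceAt K (r n) ∈ ξ.halfspaces :=
  (hξ _).2 ⟨n, fun _ hk => mem_halfspaceAt.2 (hr.side_eq hmn hk h)⟩

theorem isGeodesicRay_of_side_ne {r : ℕ → RAAG Γ}
    (h : ∀ n, ∃ e : Edge Γ, e.ends = s(r n, r (n + 1)) ∧
      ∀ m > n, side e.dual (r n) ≠ side e.dual (r m)) : IsGeodesicRay Γ r := by
  intro m n
  induction n generalizing m with
  | zero => simp
  | succ n ih =>
    obtain ⟨e, he, hs⟩ := h m
    have h1 := dist_lt_of_side_ne he (hs (m + (n + 1)) (by omega))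
    have h2 := ih (m + 1)
    have h3 := dist_triangle (r m) (r (m + 1)) (r (m + (n + 1)))
    rw [SimpleGraph.dist_eq_one_iff_adj.2 (adj_iff.2 ⟨e, he⟩)] at h3
    rw [show m + 1 + n = m + (n + 1) by omega] at h2
    omega

/-! ### Rays towards a boundary point -/

/-- If `y` is the point of a halfspace nearest to `x`, every hyperplane that separates `x` from
`y` bounds a halfspace that contains the given one but not `x`. -/
theorem halfspace_subset_of_nearest {H K : Hyperplane Γ} {x y : RAAG Γ}
    (hxy : side H x ≠ side H y)
    (hy : ∀ z, side H y = side H z → (oneSkeleton Γ).dist x y ≤ (oneSkeleton Γ).dist x z)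
    (hK : side K x ≠ side K y) :
    (halfspaceAt H y).carrier ⊆ (halfspaceAt K y).carrier := by
  intro z hz
  rw [mem_halfspaceAt] at hz ⊢
  by_contra hzK
  obtain ⟨y', hadj, hd⟩ := exists_adj_dist (x := y) (y := x) (by rintro rfl; exact hxy rfl)
  rw [SimpleGraph.dist_comm, SimpleGraph.dist_comm (u := y)] at hd
  -- The neighbour of `y` towards `x` is closer to `x`, so by minimality it has left the halfspace.
  have hyy' : side H y ≠ side H y' := fun h => by
    have := hy y' h
    omega
  obtain ⟨e, he⟩ := adj_iff.1 hadj
  have hdual := dual_eq_of_side_ne he hyy'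
  have hKy' : side K y = side K y' := by
    by_contra h
    have hKH : K = H := (dual_eq_of_side_ne he h).symm.trans hdual
    exact hzK (hKH ▸ hz)
  -- A point `z` violating the inclusion would make `K` cross `H`, hence be dual to an edge of the
  -- link coset of `y`. But `y` is nearest to `x` in that coset, so `K` could not separate them.
  have hcross : e.dual.Crosses K := by
    rw [hdual]
    refine crosses_of_quadrants (x := y) (y := z) (z := x) (t := y') hz
      (side_eq_of_ne_of_ne hxy.symm hyy') hxy.symm hzK ?_
    rwa [← hKy']
  obtain ⟨u, hu, w, hw, hKd⟩ := hcross.exists_dual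
  have hcoset : ∀ u ∈ special Γ (Γ.neighborSet e.label),
      (oneSkeleton Γ).dist x y ≤ (oneSkeleton Γ).dist x (y * u) := by
    intro u hu
    refine hy _ (side_eq_of_reachable (reachable_mul_special ?_ hu))
    rw [← hdual, label_dual]
  have hside := side_eq_of_nearest hcoset hu hw
  have hKd' : Edge.dual ⟨y * u, w⟩ = K := by
    rcases ends_eq_iff.1 he with ⟨rfl, -⟩ | ⟨-, rfl⟩
    · exact hKd
    · rw [mul_assoc, (commute_of_mem_special_link hu).eq, ← mul_assoc, dual_mul_gen hw.symm, hKd]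
  rw [hKd'] at hside
  exact hK hside

/-- The distance from `x` to the halfspace of `H` selected by `ξ`. -/
noncomputable def distToSide (ξ : RollerBoundary Γ) (H : Hyperplane Γ) (x : RAAG Γ) : ℕ :=
  sInf ((oneSkeleton Γ).dist x '' {y | halfspaceAt H y ∈ ξ.halfspaces})

/-- Take the first edge of a geodesic to a nearest vertex on the selected side of `H`. The far side
of the hyperplane it crosses contains that selected halfspace, so it is selected as well. -/
theorem exists_step_towards (ξ : RollerBoundary Γ) {H : Hyperplane Γ} {x : RAAG Γ}
    (hx : halfspaceAt H x ∉ ξ.halfspaces) :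
    ∃ z, ∃ e : Edge Γ, e.ends = s(x, z) ∧ halfspaceAt e.dual x ∉ ξ.halfspaces ∧
      distToSide ξ H z < distToSide ξ H x := by
  obtain ⟨y₀, hy₀⟩ := exists_side_ne H x
  have hy₀ξ : halfspaceAt H y₀ ∈ ξ.halfspaces := (halfspaceAt_mem_iff ξ hy₀.symm).2 hx
  obtain ⟨y, hyξ, hy⟩ := Nat.sInf_mem
    (s := (oneSkeleton Γ).dist x '' {y | halfspaceAt H y ∈ ξ.halfspaces}) ⟨_, y₀, hy₀ξ, rfl⟩
  change (oneSkeleton Γ).dist x y = distToSide ξ H x at hy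
  have hxy : side H x ≠ side H y := fun h => hx (halfspaceAt_congr h ▸ hyξ)
  obtain ⟨z, hz, hd⟩ := exists_adj_dist (x := x) (y := y) (by rintro rfl; exact hxy rfl)
  obtain ⟨e, he⟩ := adj_iff.1 hz
  have hside := side_ne_of_dist_lt he (y := y) (by omega)
  refine ⟨z, e, he, ?_, ?_⟩
  · have hsub := halfspace_subset_of_nearest hxy (fun t ht => ?_) hside
    · exact (halfspaceAt_mem_iff ξ hside.symm).1 (mem_halfspaces_of_subset ξ hyξ hsub)
    · rw [hy]
      exact Nat.sInf_le ⟨t, by rwa [Set.mem_ofPred_eq, ← halfspaceAt_congr ht], rfl⟩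
  · have : distToSide ξ H z ≤ (oneSkeleton Γ).dist z y := Nat.sInf_le ⟨y, hyξ, rfl⟩
    omega

instance [Finite V] : Countable (RAAG Γ) := by
  classical
  have : Countable (FreeGroup V) := FreeGroup.toWord_injective.countable
  exact (PresentedGroup.mk_surjective (relators Γ)).countable

instance [Finite V] : Countable (Edge Γ) := by
  have : Function.Injective fun e : Edge Γ => (e.base, e.label) := fun e e' h =>
    Edge.ext (Prod.ext_iff.1 h).1 (Prod.ext_iff.1 h).2
  exact this.countable

instance [Finite V] : Countable (Hyperplane Γ) :=
  inferInstanceAs (Countable (Quot _))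

instance [Finite V] : Countable (Halfspace Γ) := by
  have : Function.Surjective fun p : Hyperplane Γ × RAAG Γ => halfspaceAt p.1 p.2 := by
    intro h
    obtain ⟨x, hx⟩ := h.nonempty
    exact ⟨(h.boundary, x), (eq_halfspaceAt hx).symm⟩
  exact this.countable

/-- Every point of the Roller boundary is represented by a geodesic ray. -/
theorem exists_ray [Finite V] (ξ : RollerBoundary Γ) :
    ∃ r : ℕ → RAAG Γ, IsGeodesicRay Γ r ∧ Represents r ξ := by
  obtain ⟨idx, hidx⟩ := exists_injective_nat (Hyperplane Γ)
  -- At each vertex, aim for the hyperplane of least index whose selected side has not been reached.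
  have htarget : ∀ x : RAAG Γ, ∃ H : Hyperplane Γ, halfspaceAt H x ∉ ξ.halfspaces ∧
      ∀ K : Hyperplane Γ, halfspaceAt K x ∉ ξ.halfspaces → idx H ≤ idx K := by
    intro x
    obtain ⟨H₀, hH₀⟩ := exists_halfspaceAt_notMem ξ x
    obtain ⟨H, hH, hmin⟩ := Nat.sInf_mem
      (s := idx '' {H | halfspaceAt H x ∉ ξ.halfspaces}) ⟨_, H₀, hH₀, rfl⟩
    exact ⟨H, hH, fun K hK => hmin ▸ Nat.sInf_le ⟨K, hK, rfl⟩⟩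
  choose target htarget hmin using htarget
  choose next edge hends hsep hdist using fun x => exists_step_towards ξ (htarget x)
  let r : ℕ → RAAG Γ := fun n => next^[n] 1
  have hr : ∀ n, r (n + 1) = next (r n) := fun n => Function.iterate_succ_apply' _ _ _
  have hstep : ∀ (K : Hyperplane Γ) n, halfspaceAt K (r n) ∈ ξ.halfspaces →
      halfspaceAt K (r (n + 1)) ∈ ξ.halfspaces := by
    intro K n hK
    by_cases hs : side K (r n) = side K (r (n + 1))
    · rwa [← halfspaceAt_congr hs]
    · rw [hr] at hs
      have hd := dual_eq_of_side_ne (hends (r n)) hs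
      exact absurd (hd ▸ hK) (hsep (r n))
  have hmono : ∀ (K : Hyperplane Γ) n m, n ≤ m → halfspaceAt K (r n) ∈ ξ.halfspaces →
      halfspaceAt K (r m) ∈ ξ.halfspaces := by
    intro K n m hnm hK
    induction m, hnm using Nat.le_induction with
    | base => exact hK
    | succ m _ ih => exact hstep K m ih
  -- Once all hyperplanes of smaller index are settled, `K` would remain the target forever, and the
  -- distance to its selected side would decrease without end.
  have hall : ∀ K : Hyperplane Γ, ∃ n, halfspaceAt K (r n) ∈ ξ.halfspaces := by
    intro K
    induction hk : idx K using Nat.strong_induction_on generalizing K with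
    | _ k ih =>
    by_contra! hno
    obtain ⟨N, hN⟩ : ∃ N, ∀ L : Hyperplane Γ, idx L < k → halfspaceAt L (r N) ∈ ξ.halfspaces := by
      have hfin : {L | idx L < k}.Finite := (Set.finite_lt_nat k).preimage hidx.injOn
      choose! n hn using fun L (hL : idx L < k) => ih (idx L) hL L rfl
      obtain ⟨N, hN⟩ := (hfin.image n).bddAbove
      exact ⟨N, fun L hL => hmono L _ _ (hN ⟨L, hL, rfl⟩) (hn L hL)⟩
    have hK : ∀ n ≥ N, target (r n) = K := by
      intro n hn
      refine hidx (le_antisymm (hmin _ K (hno n)) ?_)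
      by_contra! hlt
      exact htarget (r n) (hmono _ N n hn (hN _ (hk ▸ hlt)))
    have hdec : ∀ m, distToSide ξ K (r (N + m)) + m ≤ distToSide ξ K (r N) := by
      intro m
      induction m with
      | zero => simp
      | succ m ihm =>
        have := hdist (r (N + m))
        rw [hK _ (Nat.le_add_right N m), ← hr] at this
        rw [add_assoc N m 1] at this
        omega
    have := hdec (distToSide ξ K (r N) + 1)
    omega
  refine ⟨r, isGeodesicRay_of_side_ne fun n => ⟨edge (r n), hr n ▸ hends (r n), ?_⟩, ?_⟩
  · intro m hm hs
    have h1 := (halfspaceAt_mem_iff ξ (side_ne_of_ends (hends (r n))).symm).2 (hsep (r n))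
    rw [← hr] at h1
    have h2 := hmono _ _ m hm h1
    rw [← halfspaceAt_congr hs] at h2
    exact hsep _ h2
  · intro h
    constructor
    · intro hh
      obtain ⟨x, hx⟩ := h.nonempty
      obtain ⟨N, hN⟩ := hall h.boundary
      refine ⟨N, fun n hn => ?_⟩
      by_contra hxn
      rw [eq_halfspaceAt hx] at hh
      exact (halfspaceAt_mem_iff ξ (side_ne_of_mem_of_notMem hx hxn)).1 hh (hmono _ N n hn hN)
    · rintro ⟨N, hN⟩
      obtain ⟨N', hN'⟩ := hall h.boundary
      rw [eq_halfspaceAt (hN (max N N') (le_max_left _ _))]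
      exact hmono _ _ _ (le_max_right _ _) hN'

/-! ### Standard subcomplexes as cosets -/

/-- The standard subcomplex of type `Λ` that contains the vertex `g`. -/
def standard (Γ : SimpleGraph V) (g : RAAG Γ) (Λ : Set V) : Set (Cube Γ) :=
  {c | c.dirs ⊆ Λ ∧ g⁻¹ * c.base ∈ special Γ Λ}

theorem standard_mono {g : RAAG Γ} {Λ Λ' : Set V} (h : Λ ⊆ Λ') :
    standard Γ g Λ ⊆ standard Γ g Λ' :=
  fun _ hc => ⟨hc.1.trans h, special_mono h hc.2⟩

theorem standard_eq_of_mem {g g' : RAAG Γ} {Λ : Set V} (h : g⁻¹ * g' ∈ special Γ Λ) :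
    standard Γ g Λ = standard Γ g' Λ := by
  ext c
  refine and_congr_right fun _ => ?_
  have : g⁻¹ * c.base = g⁻¹ * g' * (g'⁻¹ * c.base) := by group
  rw [this, Subgroup.mul_mem_cancel_left _ h]

theorem component_subset_standard {Λ : Set V} {c : Cube Γ} (hc : c.dirs ⊆ Λ) :
    component (covering Γ ⁻¹' salvettiSub Γ Λ) c ⊆ standard Γ c.base Λ := by
  intro c' h
  induction h with
  | refl => exact ⟨hc, by simp⟩
  | @tail b d _ hbd ih =>
    obtain ⟨-, hd, hf⟩ := hbd
    refine ⟨hd, ?_⟩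
    rcases hf with ⟨v, hv, -, hb⟩ | ⟨v, hv, -, hb⟩
    · rcases hb with hb | hb
      · exact hb ▸ ih.2
      · have := mul_mem ih.2 (inv_mem (gen_mem_special (hd hv)))
        rwa [hb, mul_assoc, mul_inv_cancel_right] at this
    · rcases hb with hb | hb
      · rw [hb]
        exact ih.2
      · rw [hb, ← mul_assoc]
        exact mul_mem ih.2 (gen_mem_special (ih.1 hv))

theorem mem_component_symm {S : Set (Cube Γ)} {c c' : Cube Γ} (h : c' ∈ component S c) :
    c ∈ component S c' := by
  induction h with
  | refl => exact Relation.ReflTransGen.refl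
  | tail _ h ih => exact Relation.ReflTransGen.head ⟨h.2.1, h.1, h.2.2.symm⟩ ih

/-- Remove the directions of the cube one at a time, always keeping the face at the base. -/
theorem vertexCube_mem_component [Finite V] {Λ : Set V} {c : Cube Γ} (hc : c.dirs ⊆ Λ) :
    vertexCube Γ c.base ∈ component (covering Γ ⁻¹' salvettiSub Γ Λ) c := by
  induction hn : c.dirs.ncard generalizing c with
  | zero =>
    rw [Set.ncard_eq_zero (Set.toFinite _)] at hn
    have : vertexCube Γ c.base = c := Cube.ext rfl hn.symm
    rw [this]
    exact Relation.ReflTransGen.refl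
  | succ n ih =>
    obtain ⟨v, hv⟩ := (Set.ncard_pos (Set.toFinite _)).1 (by omega : 0 < c.dirs.ncard)
    let c' : Cube Γ := ⟨c.base, c.dirs \ {v}, c.isClique.subset Set.sdiff_subset⟩
    have hc' : c'.dirs ⊆ Λ := Set.sdiff_subset.trans hc
    refine Relation.ReflTransGen.head (b := c') ⟨hc, hc', Or.inr ⟨v, hv, rfl, Or.inl rfl⟩⟩
      (ih (c := c') hc' ?_)
    change (c.dirs \ {v}).ncard = n
    rw [Set.ncard_sdiff_singleton_of_mem hv]
    omega

theorem vertexCube_mul_mem_component {Λ : Set V} (g : RAAG Γ) {u : RAAG Γ}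
    (hu : u ∈ special Γ Λ) :
    vertexCube Γ (g * u) ∈
      component (covering Γ ⁻¹' salvettiSub Γ Λ) (vertexCube Γ g) := by
  have aux : ∀ (x : RAAG Γ), ∀ v ∈ Λ, vertexCube Γ (x * gen Γ v) ∈
      component (covering Γ ⁻¹' salvettiSub Γ Λ) (vertexCube Γ x) := by
    intro x v hv
    let e : Edge Γ := ⟨x, v⟩
    have he : e.toCube ∈ covering Γ ⁻¹' salvettiSub Γ Λ := Set.singleton_subset_iff.2 hv
    have hx : ∀ y, vertexCube Γ y ∈ covering Γ ⁻¹' salvettiSub Γ Λ := fun y => Set.empty_subset _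
    have hd : (∅ : Set V) = {v} \ {v} := by simp
    exact (Relation.ReflTransGen.single ⟨hx _, he, Or.inl ⟨v, rfl, hd, Or.inl rfl⟩⟩).tail
      ⟨he, hx _, Or.inr ⟨v, rfl, hd, Or.inr rfl⟩⟩
  refine special_induction (p := fun u => vertexCube Γ (g * u) ∈
      component (covering Γ ⁻¹' salvettiSub Γ Λ) (vertexCube Γ g)) ?_ ?_ ?_ hu
  · rw [mul_one]
    exact Relation.ReflTransGen.refl
  · intro k _ v hv ih
    rw [← mul_assoc]
    exact Relation.ReflTransGen.trans ih (aux _ v hv)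
  · intro k _ v hv ih
    rw [← mul_assoc]
    have := mem_component_symm (aux (g * k * (gen Γ v)⁻¹) v hv)
    rw [inv_mul_cancel_right] at this
    exact Relation.ReflTransGen.trans ih this

theorem component_eq_standard [Finite V] {Λ : Set V} {c : Cube Γ} (hc : c.dirs ⊆ Λ) :
    component (covering Γ ⁻¹' salvettiSub Γ Λ) c = standard Γ c.base Λ := by
  refine (component_subset_standard hc).antisymm fun c' hc' => ?_
  have h := vertexCube_mul_mem_component c.base hc'.2
  rw [mul_inv_cancel_left] at h
  exact ((vertexCube_mem_component hc).trans h).trans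
    (mem_component_symm (vertexCube_mem_component hc'.1))

theorem isStandardOfType_iff [Finite V] {Λ : Set V} {Y : Set (Cube Γ)} :
    IsStandardOfType Γ Λ Y ↔ ∃ g, Y = standard Γ g Λ := by
  constructor
  · rintro ⟨c, hc, rfl⟩
    exact ⟨c.base, component_eq_standard hc⟩
  · rintro ⟨g, rfl⟩
    have : (vertexCube Γ g).dirs ⊆ Λ := Set.empty_subset _
    exact ⟨vertexCube Γ g, this, (component_eq_standard this).symm⟩

theorem isStandard_standard [Finite V] (g : RAAG Γ) (Λ : Set V) :
    IsStandard Γ (standard Γ g Λ) :=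
  ⟨Λ, isStandardOfType_iff.2 ⟨g, rfl⟩⟩

theorem IsStandard.exists_eq [Finite V] {Y : Set (Cube Γ)} (h : IsStandard Γ Y) :
    ∃ g Λ, Y = standard Γ g Λ := by
  obtain ⟨Λ, h⟩ := h
  obtain ⟨g, hg⟩ := isStandardOfType_iff.1 h
  exact ⟨g, Λ, hg⟩

instance [Finite V] : Countable (StandardInJoin Γ) := by
  have : ∀ Y : StandardInJoin Γ, ∃ p : RAAG Γ × Set V, Y.1 = standard Γ p.1 p.2 := fun Y =>
    let ⟨g, Λ, h⟩ := Y.2.1.exists_eq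
    ⟨(g, Λ), h⟩
  choose f hf using this
  have hinj : Function.Injective f := fun Y Y' h => Subtype.ext (by rw [hf, hf, h])
  exact hinj.countable

/-! ### Virtual containment depends only on the boundary point -/

/-- All the hyperplanes that separate some vertex of `standard Γ g Λ` from `ξ` have labels
in `Λ`. -/
def LimitOf (g : RAAG Γ) (Λ : Set V) (ξ : RollerBoundary Γ) : Prop :=
  ∃ u ∈ special Γ Λ, ∀ h ∈ ξ.halfspaces, g * u ∈ h.carrier ∨ h.boundary.label ∈ Λ

/-- The right-hand side mentions no ray; independence of the ray and measurability both rest on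
this. -/
theorem virtuallyContains_iff {r : ℕ → RAAG Γ} (hr : IsGeodesicRay Γ r) {ξ : RollerBoundary Γ}
    (hξ : Represents r ξ) {g : RAAG Γ} {Λ : Set V} :
    VirtuallyContains (standard Γ g Λ) r ↔ LimitOf g Λ ξ := by
  constructor
  · rintro ⟨N, hN⟩
    refine ⟨g⁻¹ * r N, (hN N le_rfl).1.2, fun h hh => or_iff_not_imp_left.2 fun hN' => ?_⟩
    rw [mul_inv_cancel_left] at hN'
    obtain ⟨M, hM⟩ := (hξ h).1 hh
    obtain ⟨i, hi, -, hs⟩ := exists_step_crossing (le_max_left N M)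
      (side_ne_of_mem_of_notMem (hM _ (le_max_right N M)) hN').symm
    obtain ⟨e, he⟩ := adj_iff.1 (hr.adj i)
    rw [← dual_eq_of_side_ne he hs]
    exact ((hN i hi).2 e he).1 rfl
  · rintro ⟨u, hu, hlab⟩
    set x := g * u with hx
    have hfin := finite_separating (r 0) x
    have hex : ∀ K : Hyperplane Γ, ∃ N, ∀ n ≥ N, halfspaceAt K (r n) ∈ ξ.halfspaces := by
      intro K
      obtain ⟨y, hy⟩ : ∃ y, halfspaceAt K y ∈ ξ.halfspaces := by
        obtain ⟨y, hy⟩ := exists_side_ne K x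
        by_cases hyξ : halfspaceAt K y ∈ ξ.halfspaces
        · exact ⟨y, hyξ⟩
        · exact ⟨x, (halfspaceAt_mem_iff ξ hy).2 hyξ⟩
      obtain ⟨N, hN⟩ := (hξ _).1 hy
      refine ⟨N, fun n hn => ?_⟩
      rwa [← halfspaceAt_congr (mem_halfspaceAt.1 (hN n hn))]
    choose time htime using hex
    obtain ⟨N, hN⟩ := (hfin.image time).bddAbove
    -- If `K` separates `x` from `r n`, either `r` has already crossed `K`, or `K` is one of the
    -- finitely many hyperplanes separating `r 0` from `x`, for which `N` is late enough. In both
    -- cases the side of `r n` is selected.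
    have key : ∀ n ≥ N, ∀ K : Hyperplane Γ, side K x ≠ side K (r n) → K.label ∈ Λ := by
      intro n hn K hK
      have hmem : halfspaceAt K (r n) ∈ ξ.halfspaces := by
        by_cases h0 : side K (r 0) = side K x
        · exact Represents.mem_of_side_ne hr hξ (Nat.zero_le n) (h0 ▸ hK)
        · exact htime K n ((hN ⟨K, h0, rfl⟩).trans hn)
      exact (hlab _ hmem).resolve_left fun h => hK (mem_halfspaceAt.1 h).symm
    have hmem : ∀ n ≥ N, g⁻¹ * r n ∈ special Γ Λ := by
      intro n hn
      have := mul_mem hu (mem_special_of_labels (key n hn))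
      rw [hx] at this
      simpa [mul_assoc] using this
    refine ⟨N, fun n hn => ⟨⟨Set.empty_subset _, hmem n hn⟩, fun e he => ?_⟩⟩
    refine ⟨Set.singleton_subset_iff.2 ?_, ?_⟩
    · have hs := side_ne_of_ends he
      by_cases h' : side e.dual x = side e.dual (r n)
      · exact key (n + 1) (hn.trans n.le_succ) e.dual (h' ▸ hs)
      · exact key n hn e.dual h'
    · change g⁻¹ * e.base ∈ special Γ Λ
      rcases ends_eq_iff.1 he with ⟨h1, -⟩ | ⟨h1, -⟩
      · exact h1 ▸ hmem n hn
      · exact h1 ▸ hmem (n + 1) (hn.trans n.le_succ)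

/-! ### The smallest standard subcomplex -/

/-- The labels that occur infinitely often along `r`. -/
def recurrentLabels (r : ℕ → RAAG Γ) : Set V :=
  {v | ∀ N, ∃ n ≥ N, ∃ e : Edge Γ, e.ends = s(r n, r (n + 1)) ∧ e.label = v}

theorem exists_labels_subset_recurrentLabels [Finite V] (r : ℕ → RAAG Γ) :
    ∃ N, ∀ n ≥ N, ∀ e : Edge Γ, e.ends = s(r n, r (n + 1)) → e.label ∈ recurrentLabels r := by
  have : ∀ v : V, ∃ N, v ∉ recurrentLabels r →
      ∀ n ≥ N, ∀ e : Edge Γ, e.ends = s(r n, r (n + 1)) → e.label ≠ v := by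
    intro v
    by_cases hv : v ∈ recurrentLabels r
    · exact ⟨0, fun h => absurd hv h⟩
    · have hv' := hv
      simp only [recurrentLabels, Set.mem_ofPred_eq] at hv'
      push Not at hv'
      exact hv'.imp fun N hN _ => hN
  choose N hN using this
  obtain ⟨M, hM⟩ := (Set.finite_range N).bddAbove
  refine ⟨M, fun n hn e he => ?_⟩
  by_contra hv
  exact hN _ hv n ((hM ⟨_, rfl⟩).trans hn) e he rfl

theorem isLeast_standard [Finite V] {r : ℕ → RAAG Γ} (hr : IsGeodesicRay Γ r) {N : ℕ}
    (hN : ∀ n ≥ N, ∀ e : Edge Γ, e.ends = s(r n, r (n + 1)) → e.label ∈ recurrentLabels r) :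
    IsLeast {Z : Set (Cube Γ) | IsStandard Γ Z ∧ VirtuallyContains Z r}
      (standard Γ (r N) (recurrentLabels r)) := by
  have hstep : ∀ n ≥ N, (r N)⁻¹ * r n ∈ special Γ (recurrentLabels r) := by
    intro n hn
    induction n, hn using Nat.le_induction with
    | base => simp
    | succ n hn ih =>
      obtain ⟨e, he⟩ := adj_iff.1 (hr.adj n)
      have hl := gen_mem_special (Γ := Γ) (hN n hn e he)
      rcases ends_eq_iff.1 he with ⟨h1, h2⟩ | ⟨h1, h2⟩
      · rw [h2, ← h1, ← mul_assoc]
        exact mul_mem ih hl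
      · rw [h2, ← h1, ← mul_assoc] at ih
        exact (Subgroup.mul_mem_cancel_right _ hl).1 ih
  refine ⟨⟨isStandard_standard _ _, N, fun n hn => ⟨⟨Set.empty_subset _, hstep n hn⟩,
    fun e he => ⟨Set.singleton_subset_iff.2 (hN n hn e he), ?_⟩⟩⟩, ?_⟩
  · change (r N)⁻¹ * e.base ∈ _
    rcases ends_eq_iff.1 he with ⟨h1, -⟩ | ⟨h1, -⟩
    · exact h1 ▸ hstep n hn
    · exact h1 ▸ hstep (n + 1) (hn.trans n.le_succ)
  · rintro Z ⟨hZ, M, hM⟩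
    obtain ⟨g, Λ, rfl⟩ := hZ.exists_eq
    have hsub : recurrentLabels r ⊆ Λ := by
      intro v hv
      obtain ⟨n, hn, e, he, rfl⟩ := hv M
      exact ((hM n hn).2 e he).1 rfl
    have h1 := (hM _ (le_max_right N M)).1.2
    rw [standard_eq_of_mem h1, standard_eq_of_mem (hstep _ (le_max_left N M))]
    exact standard_mono hsub

/-- A standard subcomplex that is smallest for one ray is smallest for the boundary point. -/
theorem isSmallestFor_of_isLeast [Finite V] {r : ℕ → RAAG Γ} (hr : IsGeodesicRay Γ r)
    {ξ : RollerBoundary Γ} (hξ : Represents r ξ) {Y : Set (Cube Γ)}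
    (hY : IsLeast {Z : Set (Cube Γ) | IsStandard Γ Z ∧ VirtuallyContains Z r} Y) :
    IsSmallestFor Y ξ := by
  intro r' hr' hξ'
  have : {Z : Set (Cube Γ) | IsStandard Γ Z ∧ VirtuallyContains Z r'} =
      {Z : Set (Cube Γ) | IsStandard Γ Z ∧ VirtuallyContains Z r} := by
    ext Z
    refine and_congr_right fun hZ => ?_
    obtain ⟨g, Λ, rfl⟩ := hZ.exists_eq
    rw [virtuallyContains_iff hr hξ, virtuallyContains_iff hr' hξ']
  rwa [this]

/-- The existence of a representing ray keeps `IsSmallestFor` from being vacuous. -/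
theorem IsSmallestFor.unique [Finite V] {ξ : RollerBoundary Γ} {Y Y' : Set (Cube Γ)}
    (h : IsSmallestFor Y ξ) (h' : IsSmallestFor Y' ξ) : Y = Y' := by
  obtain ⟨r, hr, hξ⟩ := exists_ray ξ
  exact (h r hr hξ).unique (h' r hr hξ)

theorem isSmallestFor_standard_iff [Finite V] {ξ : RollerBoundary Γ} {g : RAAG Γ} {Λ : Set V} :
    IsSmallestFor (standard Γ g Λ) ξ ↔ LimitOf g Λ ξ ∧
      ∀ (k : RAAG Γ) (Λ' : Set V), LimitOf k Λ' ξ → standard Γ g Λ ⊆ standard Γ k Λ' := by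
  constructor
  · intro h
    obtain ⟨r, hr, hξ⟩ := exists_ray ξ
    obtain ⟨⟨-, h1⟩, h2⟩ := h r hr hξ
    exact ⟨(virtuallyContains_iff hr hξ).1 h1, fun k Λ' hk =>
      h2 ⟨isStandard_standard k Λ', (virtuallyContains_iff hr hξ).2 hk⟩⟩
  · rintro ⟨h1, h2⟩ r hr hξ
    refine ⟨⟨isStandard_standard g Λ, (virtuallyContains_iff hr hξ).2 h1⟩, ?_⟩
    rintro Z ⟨hZ, hv⟩
    obtain ⟨k, Λ', rfl⟩ := hZ.exists_eq
    exact h2 k Λ' ((virtuallyContains_iff hr hξ).1 hv)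

/-! ### Equivariance -/

theorem standard_smul (g k : RAAG Γ) (Λ : Set V) :
    k • standard Γ g Λ = standard Γ (k * g) Λ := by
  ext c
  rw [Set.mem_smul_set_iff_inv_smul_mem]
  refine and_congr_right fun _ => ?_
  rw [cube_smul_base, mul_inv_rev, mul_assoc]

theorem limitOf_smul (g k : RAAG Γ) (Λ : Set V) (ξ : RollerBoundary Γ) (h : LimitOf g Λ ξ) :
    LimitOf (k * g) Λ (k • ξ) := by
  obtain ⟨u, hu, hlab⟩ := h
  refine ⟨u, hu, fun h hh => ?_⟩
  have := hlab _ (mem_halfspaces_smul.1 hh)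
  rw [smul_carrier, Set.mem_smul_set_iff_inv_smul_mem, inv_inv, smul_eq_mul, ← mul_assoc] at this
  refine this.imp_right fun h' => ?_
  have hl : ∀ H : Hyperplane Γ, (k⁻¹ • H).label = H.label := by
    intro H
    obtain ⟨e, rfl⟩ := Quot.exists_rep H
    rfl
  rwa [smul_boundary, hl] at h'

theorem IsSmallestFor.smul [Finite V] {ξ : RollerBoundary Γ} {Y : Set (Cube Γ)}
    (hY : IsStandard Γ Y) (h : IsSmallestFor Y ξ) (k : RAAG Γ) : IsSmallestFor (k • Y) (k • ξ) := by
  obtain ⟨g, Λ, rfl⟩ := hY.exists_eq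
  rw [isSmallestFor_standard_iff] at h
  rw [standard_smul, isSmallestFor_standard_iff]
  refine ⟨limitOf_smul g k Λ ξ h.1, fun k' Λ' hk' => ?_⟩
  have := limitOf_smul k' k⁻¹ Λ' _ hk'
  rw [inv_smul_smul] at this
  have := Set.smul_set_mono (a := k) (h.2 _ _ this)
  rwa [standard_smul, standard_smul, mul_inv_cancel_left] at this

/-! ### Measurability -/

theorem measurableSet_mem_halfspaces (h : Halfspace Γ) :
    MeasurableSet {ξ : RollerBoundary Γ | h ∈ ξ.halfspaces} := by
  have hc : Continuous fun ξ : RollerBoundary Γ => ξ.1 h :=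
    (continuous_apply h).comp continuous_subtype_val
  exact ((isOpen_discrete {true}).preimage hc).measurableSet

theorem measurableSet_regularPoints [Finite V] : MeasurableSet (regularPoints Γ) := by
  have : regularPoints Γ = ⋂ (h₁ : Halfspace Γ) (h₂ : Halfspace Γ),
      {ξ : RollerBoundary Γ | h₁ ∈ ξ.halfspaces}ᶜ ∪ ({ξ : RollerBoundary Γ | h₂ ∈ ξ.halfspaces}ᶜ ∪
        ⋃ k ∈ {k : Halfspace Γ | k.carrier ⊆ h₁.carrier ∩ h₂.carrier ∧
          StronglySeparated k.boundary h₁.boundary ∧ StronglySeparated k.boundary h₂.boundary},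
          {ξ : RollerBoundary Γ | k ∈ ξ.halfspaces}) := by
    ext ξ
    simp only [regularPoints, Set.mem_ofPred_eq, Set.mem_iInter, Set.mem_union, Set.mem_compl_iff,
      Set.mem_iUnion, exists_prop]
    refine forall_congr' fun h₁ => ⟨fun H h₂ => ?_, fun H hh₁ h₂ hh₂ => ?_⟩
    · by_cases hh₁ : h₁ ∈ ξ.halfspaces
      · by_cases hh₂ : h₂ ∈ ξ.halfspaces
        · obtain ⟨k, hk, hk'⟩ := H hh₁ h₂ hh₂
          exact Or.inr (Or.inr ⟨k, hk', hk⟩)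
        · exact Or.inr (Or.inl hh₂)
      · exact Or.inl hh₁
    · obtain ⟨k, hk', hk⟩ := ((H h₂).resolve_left (not_not.2 hh₁)).resolve_left (not_not.2 hh₂)
      exact ⟨k, hk, hk'⟩
  rw [this]
  refine MeasurableSet.iInter fun h₁ => MeasurableSet.iInter fun h₂ => ?_
  exact (measurableSet_mem_halfspaces h₁).compl.union
    ((measurableSet_mem_halfspaces h₂).compl.union
      (MeasurableSet.biUnion (Set.to_countable _) fun k _ => measurableSet_mem_halfspaces k))

theorem measurableSet_limitOf [Finite V] (g : RAAG Γ) (Λ : Set V) :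
    MeasurableSet {ξ : RollerBoundary Γ | LimitOf g Λ ξ} := by
  have : {ξ : RollerBoundary Γ | LimitOf g Λ ξ} = ⋃ u ∈ {u | u ∈ special Γ Λ},
      ⋂ h ∈ {h : Halfspace Γ | ¬ (g * u ∈ h.carrier ∨ h.boundary.label ∈ Λ)},
        {ξ : RollerBoundary Γ | h ∈ ξ.halfspaces}ᶜ := by
    ext ξ
    simp only [LimitOf, Set.mem_ofPred_eq, Set.mem_iInter, Set.mem_compl_iff,
      Set.mem_iUnion, exists_prop]
    refine exists_congr fun u => and_congr_right fun _ => forall_congr' fun h => ?_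
    exact not_imp_not.symm
  rw [this]
  exact MeasurableSet.biUnion (Set.to_countable _) fun u _ =>
    MeasurableSet.biInter (Set.to_countable _) fun h _ => (measurableSet_mem_halfspaces h).compl

/-- Minimality need only be tested against the countably many pairs of a group element and a set of
labels. -/
theorem measurableSet_isSmallestFor [Finite V] {Y : Set (Cube Γ)} (hY : IsStandard Γ Y) :
    MeasurableSet {ξ : RollerBoundary Γ | IsSmallestFor Y ξ} := by
  obtain ⟨g, Λ, rfl⟩ := hY.exists_eq
  have : {ξ : RollerBoundary Γ | IsSmallestFor (standard Γ g Λ) ξ} =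
      {ξ : RollerBoundary Γ | LimitOf g Λ ξ} ∩
        ⋂ p ∈ {p : RAAG Γ × Set V | ¬ standard Γ g Λ ⊆ standard Γ p.1 p.2},
          {ξ : RollerBoundary Γ | LimitOf p.1 p.2 ξ}ᶜ := by
    ext ξ
    simp only [isSmallestFor_standard_iff, Set.mem_ofPred_eq, Set.mem_inter_iff, Set.mem_iInter,
      Set.mem_compl_iff, Prod.forall]
    refine and_congr_right fun _ => forall_congr' fun k => forall_congr' fun Λ' => ?_
    exact not_imp_not.symm
  rw [this]
  exact (measurableSet_limitOf g Λ).inter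
    (MeasurableSet.biInter (Set.to_countable _) fun p _ => (measurableSet_limitOf p.1 p.2).compl)

/-! ### Halfspaces entered by a ray -/

/-- The halfspace that `r` enters along the `n`-th edge `e n`. -/
def entered (r : ℕ → RAAG Γ) (e : ℕ → Edge Γ) (n : ℕ) : Halfspace Γ :=
  halfspaceAt (e n).dual (r (n + 1))

theorem mem_entered_iff {r : ℕ → RAAG Γ} (hr : IsGeodesicRay Γ r) {e : ℕ → Edge Γ}
    (he : ∀ n, (e n).ends = s(r n, r (n + 1))) {m n : ℕ} :
    r m ∈ (entered r e n).carrier ↔ n < m := by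
  rw [entered, mem_halfspaceAt]
  have hs := side_ne_of_ends (he n)
  constructor
  · intro h
    by_contra! hmn
    exact hs (hr.side_eq hmn n.le_succ fun h' => hs (h'.symm.trans h.symm))
  · intro h
    exact hr.side_eq n.le_succ h hs

theorem entered_mem_halfspaces {r : ℕ → RAAG Γ} (hr : IsGeodesicRay Γ r) {e : ℕ → Edge Γ}
    (he : ∀ n, (e n).ends = s(r n, r (n + 1))) {ξ : RollerBoundary Γ} (hξ : Represents r ξ)
    (n : ℕ) : entered r e n ∈ ξ.halfspaces :=
  Represents.mem_of_side_ne hr hξ n.le_succ (side_ne_of_ends (he n))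

theorem dual_ne_of_lt {r : ℕ → RAAG Γ} (hr : IsGeodesicRay Γ r) {e : ℕ → Edge Γ}
    (he : ∀ n, (e n).ends = s(r n, r (n + 1))) {i j : ℕ} (hij : i < j) :
    (e i).dual ≠ (e j).dual := by
  intro h
  refine side_ne_of_ends (he j) ?_
  rw [← h]
  exact side_eq_of_mem (h := entered r e i) ((mem_entered_iff hr he).2 hij)
    ((mem_entered_iff hr he).2 (hij.trans j.lt_succ_self))

/-- A point `z` violating the inclusion would, with `r i`, `r j` and `r (j + 1)`, fill the four
quadrants; but crossing hyperplanes have adjacent labels. -/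
theorem entered_subset {r : ℕ → RAAG Γ} (hr : IsGeodesicRay Γ r) {e : ℕ → Edge Γ}
    (he : ∀ n, (e n).ends = s(r n, r (n + 1))) {i j : ℕ} (hij : i < j)
    (hl : ¬ Γ.Adj (e i).label (e j).label) :
    (entered r e j).carrier ⊆ (entered r e i).carrier := by
  intro z hz
  by_contra hzi
  refine hl ?_
  have hm := fun m n => mem_entered_iff (m := m) (n := n) hr he
  have h1 : r i ∉ (entered r e i).carrier := fun h => lt_irrefl _ ((hm _ _).1 h)
  have h2 : r i ∉ (entered r e j).carrier := fun h => lt_asymm hij ((hm _ _).1 h)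
  have h3 : r j ∉ (entered r e j).carrier := fun h => lt_irrefl _ ((hm _ _).1 h)
  have h4 := (hm j i).2 hij
  have h5 := (hm (j + 1) i).2 (hij.trans j.lt_succ_self)
  have h6 := (hm (j + 1) j).2 j.lt_succ_self
  have : (entered r e i).boundary.Crosses (entered r e j).boundary :=
    crosses_of_quadrants (side_eq_of_notMem h1 hzi) (side_eq_of_mem h4 h5)
      (side_ne_of_mem_of_notMem h4 h1).symm (side_ne_of_mem_of_notMem hz h2).symm
      (side_ne_of_mem_of_notMem h6 h3).symm
  exact this.adj_label

/-! ### Regularity of rays that leave every join subcomplex -/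

/-- The complement graph of a subgraph that is not a join is connected. -/
theorem reflTransGen_of_not_isJoin {Λ : Set V} (hΛ : ¬ IsJoin Γ Λ) {a b : V} (ha : a ∈ Λ)
    (hb : b ∈ Λ) : Relation.ReflTransGen (fun x y => y ∈ Λ ∧ ¬ Γ.Adj x y) a b := by
  by_contra hab
  refine hΛ ⟨{x ∈ Λ | Relation.ReflTransGen (fun x y => y ∈ Λ ∧ ¬ Γ.Adj x y) a x},
    {x ∈ Λ | ¬ Relation.ReflTransGen (fun x y => y ∈ Λ ∧ ¬ Γ.Adj x y) a x},
    ⟨a, ha, .refl⟩, ⟨b, hb, hab⟩, ?_, ?_, ?_⟩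
  · exact Set.disjoint_left.2 fun x hx hx' => hx'.2 hx.2
  · ext x
    refine ⟨fun h => h.elim And.left And.left, fun hx => ?_⟩
    exact (em _).imp (fun h => ⟨hx, h⟩) fun h => ⟨hx, h⟩
  · rintro x ⟨-, hx⟩ y ⟨hy, hay⟩
    by_contra hxy
    exact hay (hx.tail ⟨hy, hxy⟩)

/-- The halfspace `entered r e j` is contained in `entered r e i`, and every hyperplane that crosses
both of their boundaries has a label adjacent to all of `S`. -/
def Blocks (r : ℕ → RAAG Γ) (e : ℕ → Edge Γ) (i j : ℕ) (S : Set V) : Prop :=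
  i ≤ j ∧ (entered r e j).carrier ⊆ (entered r e i).carrier ∧
    ∀ L : Hyperplane Γ, L.Crosses (e i).dual → L.Crosses (e j).dual → ∀ s ∈ S, Γ.Adj L.label s

/-- A hyperplane crossing the two outer boundaries crosses the middle one, so it inherits the old
constraints, and crossing `e k` adds the new one. -/
theorem Blocks.extend {r : ℕ → RAAG Γ} (hr : IsGeodesicRay Γ r) {e : ℕ → Edge Γ}
    (he : ∀ n, (e n).ends = s(r n, r (n + 1))) {i j k : ℕ} {S : Set V} (h : Blocks r e i j S)
    (hjk : j < k) (hl : ¬ Γ.Adj (e j).label (e k).label) :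
    Blocks r e i k (insert (e k).label S) := by
  obtain ⟨hij, hsub, hS⟩ := h
  have hkj := entered_subset hr he hjk hl
  refine ⟨hij.trans hjk.le, hkj.trans hsub, ?_⟩
  rintro L hi hk s (rfl | hs)
  · exact hk.adj_label
  · exact hS L hi (crosses_of_subset (l := entered r e j) (h := entered r e i)
      (k := entered r e k) hkj hsub hk hi) s hs

section chain

variable {r : ℕ → RAAG Γ} {e : ℕ → Edge Γ} {Λ : Set V}

/-- Add the labels of `Λ` one by one. To reach `u`, follow a walk in the complement graph of `Λ`,
realizing each of its vertices by a later edge of the ray, as recurrence allows. -/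
theorem exists_blocks [Finite V] (hr : IsGeodesicRay Γ r)
    (he : ∀ n, (e n).ends = s(r n, r (n + 1))) (hΛ : ¬ IsJoin Γ Λ)
    (hrec : ∀ v ∈ Λ, ∀ N, ∃ n ≥ N, (e n).label = v) {i : ℕ} (hi : (e i).label ∈ Λ) :
    ∃ j, (e j).label ∈ Λ ∧ Blocks r e i j Λ := by
  suffices ∀ S : Set V, S.Finite → S ⊆ Λ → ∃ j, (e j).label ∈ Λ ∧ Blocks r e i j S from
    this Λ (Set.toFinite _) subset_rfl
  intro S hS
  induction S, hS using Set.Finite.induction_on with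
  | empty => exact fun _ => ⟨i, hi, le_rfl, subset_rfl, by simp⟩
  | @insert u S hu_not _ ih =>
    intro hsub
    obtain ⟨j, hj, hb⟩ := ih ((Set.subset_insert _ _).trans hsub)
    have hu : u ∈ Λ := hsub (Set.mem_insert _ _)
    have hwalk := reflTransGen_of_not_isJoin hΛ hj hu
    suffices ∃ m, (e m).label = u ∧ Blocks r e i m (insert u S) by
      obtain ⟨m, hm, hb'⟩ := this
      exact ⟨m, hm ▸ hu, hb'⟩
    clear hsub hu hu_not
    induction hwalk with
    | refl =>
      refine ⟨j, rfl, hb.1, hb.2.1, ?_⟩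
      rintro L h1 h2 s (rfl | hs)
      · exact h2.adj_label
      · exact hb.2.2 L h1 h2 s hs
    | @tail b c _ hbc ihm =>
      obtain ⟨m, hm, hbm⟩ := ihm
      obtain ⟨n, hn, hnc⟩ := hrec c hbc.1 (m + 1)
      refine ⟨n, hnc, ?_⟩
      have := hbm.extend hr he hn (by rw [hm, hnc]; exact hbc.2)
      rw [hnc] at this
      -- Intermediate labels of the walk are forgotten; only the last one is kept beside `S`.
      exact ⟨this.1, this.2.1, fun L h1 h2 s hs => this.2.2 L h1 h2 s
        (hs.imp_right (Set.mem_insert_of_mem _))⟩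

theorem exists_stronglySeparated [Finite V] (hr : IsGeodesicRay Γ r)
    (he : ∀ n, (e n).ends = s(r n, r (n + 1))) (hΛ : ¬ IsJoin Γ Λ)
    (hlink : ¬ ∃ b, ∀ a ∈ Λ, Γ.Adj b a)
    (hrec : ∀ v ∈ Λ, ∀ N, ∃ n ≥ N, (e n).label = v) {i : ℕ} (hi : (e i).label ∈ Λ) :
    ∃ j > i, (e j).label ∈ Λ ∧ (entered r e j).carrier ⊆ (entered r e i).carrier ∧
      StronglySeparated (entered r e j).boundary (entered r e i).boundary := by
  obtain ⟨j, hj, hb⟩ := exists_blocks hr he hΛ hrec hi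
  -- `exists_blocks` may return `j = i`. One more edge with the same label, not adjacent to itself,
  -- makes the index strictly larger and the boundaries distinct.
  obtain ⟨m, hm, hl⟩ := hrec _ hj (j + 1)
  obtain ⟨-, hsub, hblock⟩ := hb.extend hr he hm (by rw [hl]; exact Γ.irrefl)
  have him : i < m := hb.1.trans_lt hm
  exact ⟨m, him, hl ▸ hj, hsub, stronglySeparated_of_subset hsub
    (dual_ne_of_lt hr he him).symm fun L h1 h2 => hlink
      ⟨L.label, fun a ha => hblock L h2 h1 a (Set.mem_insert_of_mem _ ha)⟩⟩

end chain

/-- A boundary point is regular if it selects a descending sequence of halfspaces, with distinct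
boundaries, consecutive ones being strongly separated, such that some vertex lies in none of
them. -/
theorem mem_regularPoints_of_chain {ξ : RollerBoundary Γ} {a : ℕ → Halfspace Γ}
    (ha : ∀ n, a n ∈ ξ.halfspaces) (hinj : Function.Injective fun n => (a n).boundary)
    (hanti : ∀ n, (a (n + 1)).carrier ⊆ (a n).carrier)
    (hsep : ∀ n, StronglySeparated (a (n + 1)).boundary (a n).boundary)
    {x₀ : RAAG Γ} (hx₀ : ∀ n, x₀ ∉ (a n).carrier) : ξ ∈ regularPoints Γ := by
  have hmono : ∀ {m n}, m ≤ n → (a n).carrier ⊆ (a m).carrier := fun {m n} hmn =>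
    antitone_nat_of_succ_le (f := fun n => (a n).carrier) hanti hmn
  -- Only finitely many hyperplanes separate `y` from `x₀`.
  have hescape : ∀ y, ∃ n, y ∉ (a n).carrier := by
    intro y
    by_contra! hy
    refine Set.infinite_range_of_injective hinj ((finite_separating y x₀).subset ?_)
    rintro _ ⟨n, rfl⟩
    exact side_ne_of_mem_of_notMem (hy n) (hx₀ n)
  have hsub : ∀ h ∈ ξ.halfspaces, ∃ n, (a n).carrier ⊆ h.carrier := by
    intro h hh
    by_contra! hno
    -- The selected sides of `h` and `a n` intersect, and `a n` has a point outside `h`. If the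
    -- boundaries do not meet, one of the other two quadrants is empty.
    have hcase : ∀ n, ¬ h.boundary.Meets (a n).boundary →
        h.carrier ⊆ (a n).carrier ∨ h.carrierᶜ ⊆ (a n).carrier := by
      intro n hn
      by_contra! hc
      obtain ⟨⟨y, hy, hya⟩, z, hz, hza⟩ := hc.imp Set.not_subset.1 Set.not_subset.1
      obtain ⟨t, ht, hth⟩ := Set.not_subset.1 (hno n)
      obtain ⟨s, hs⟩ := exists_vertex_agreeing ξ (Set.toFinite {h, a n})
      have hsh := (hs h (by simp)).1 hh
      have hsa := (hs (a n) (by simp)).1 (ha n)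
      exact hn (crosses_of_quadrants (side_eq_of_mem hsh hy) (side_eq_of_notMem hth hz)
        (side_ne_of_mem_of_notMem hsh hth) (side_ne_of_mem_of_notMem hsa hya)
        (side_ne_of_mem_of_notMem ht hza)).meets
    -- A boundary that meets that of `a n` cannot meet that of `a (n + 1)`. So every `a n` would
    -- contain `h` or its complement, although a point of each escapes the chain.
    have hcase' : ∀ n, h.carrier ⊆ (a n).carrier ∨ h.carrierᶜ ⊆ (a n).carrier := by
      intro n
      by_cases hn : h.boundary.Meets (a n).boundary
      · exact (hcase (n + 1) fun hn' => hsep n ⟨_, hn', hn⟩).imp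
          (fun h => h.trans (hanti n)) fun h => h.trans (hanti n)
      · exact hcase n hn
    obtain ⟨y, hy⟩ := h.nonempty
    obtain ⟨z, hz⟩ := h.exists_notMem
    obtain ⟨m, hm⟩ := hescape y
    obtain ⟨n, hn⟩ := hescape z
    rcases hcase' (max m n) with h' | h'
    · exact hm (hmono (le_max_left m n) (h' hy))
    · exact hn (hmono (le_max_right m n) (h' hz))
  -- Going one term further suffices: a hyperplane meeting the boundaries of `h` and `a (n + 1)`
  -- also meets that of `a n`, between them.
  have hkey : ∀ h ∈ ξ.halfspaces, ∃ N, ∀ n ≥ N, (a (n + 1)).carrier ⊆ h.carrier ∧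
      StronglySeparated (a (n + 1)).boundary h.boundary := by
    intro h hh
    obtain ⟨N, hN⟩ := hsub h hh
    refine ⟨N, fun n hn => ?_⟩
    have hn' := (hmono hn).trans hN
    refine ⟨(hanti n).trans hn', ?_⟩
    rintro ⟨L, h1, h2⟩
    exact hsep n ⟨L, h1, meets_of_subset (hanti n) hn' h1 h2⟩
  intro h₁ hh₁ h₂ hh₂
  obtain ⟨N₁, hN₁⟩ := hkey h₁ hh₁
  obtain ⟨N₂, hN₂⟩ := hkey h₂ hh₂
  obtain ⟨h1, h1'⟩ := hN₁ _ (le_max_left N₁ N₂)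
  obtain ⟨h2, h2'⟩ := hN₂ _ (le_max_right N₁ N₂)
  exact ⟨_, ha _, Set.subset_inter h1 h2, h1', h2'⟩

/-- The recurrent labels of a ray that represents a non-regular point span a subgraph of a join. -/
theorem exists_isJoin_of_not_regular [Finite V] {r : ℕ → RAAG Γ} (hr : IsGeodesicRay Γ r)
    {ξ : RollerBoundary Γ} (hξ : Represents r ξ) (hreg : ξ ∉ regularPoints Γ) :
    ∃ Λ, IsJoin Γ Λ ∧ recurrentLabels r ⊆ Λ := by
  by_contra! hno
  refine hreg ?_
  obtain ⟨N, hN⟩ := exists_labels_subset_recurrentLabels r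
  choose e he using fun n => adj_iff.1 (hr.adj n)
  have hrec : ∀ v ∈ recurrentLabels r, ∀ N, ∃ n ≥ N, (e n).label = v := by
    intro v hv M
    obtain ⟨n, hn, e', he', rfl⟩ := hv M
    exact ⟨n, hn, congrArg Hyperplane.label (dual_eq_of_side_ne (he n) (side_ne_of_ends he'))⟩
  have hjoin : ¬ IsJoin Γ (recurrentLabels r) := fun h => hno _ h subset_rfl
  -- Such a `b` would be the cone point of a join containing all recurrent labels.
  have hlink : ¬ ∃ b, ∀ a ∈ recurrentLabels r, Γ.Adj b a := by
    rintro ⟨b, hb⟩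
    refine hno ({b} ∪ recurrentLabels r) ⟨{b}, recurrentLabels r, Set.singleton_nonempty b,
      ⟨_, hN N le_rfl _ (he N)⟩, ?_, rfl, ?_⟩ Set.subset_union_right
    · exact Set.disjoint_singleton_left.2 fun h => Γ.irrefl (hb b h)
    · rintro _ rfl a ha
      exact hb a ha
  have hnext : ∀ i : {i // N ≤ i ∧ (e i).label ∈ recurrentLabels r},
      ∃ j : {i // N ≤ i ∧ (e i).label ∈ recurrentLabels r}, i.1 < j.1 ∧
        (entered r e j).carrier ⊆ (entered r e i).carrier ∧
        StronglySeparated (entered r e j).boundary (entered r e i).boundary := by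
    rintro ⟨i, hi, hl⟩
    obtain ⟨j, hj, hlj, h⟩ := exists_stronglySeparated hr he hjoin hlink hrec hl
    exact ⟨⟨j, hi.trans hj.le, hlj⟩, hj, h⟩
  choose next hlt hsub hsep using hnext
  let t : ℕ → {i // N ≤ i ∧ (e i).label ∈ recurrentLabels r} :=
    fun n => next^[n] ⟨N, le_rfl, hN N le_rfl _ (he N)⟩
  have ht : ∀ n, t (n + 1) = next (t n) := fun n => Function.iterate_succ_apply' _ _ _
  have htmono : StrictMono fun n => (t n).1 := strictMono_nat_of_lt_succ fun n => by
    rw [ht]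
    exact hlt _
  refine mem_regularPoints_of_chain (a := fun n => entered r e (t n)) (x₀ := r N)
    (fun n => entered_mem_halfspaces hr he hξ _) ?_ ?_ ?_ ?_
  · refine Function.Injective.comp (g := fun n => (e n).dual) ?_ htmono.injective
    intro i j hij
    rcases lt_trichotomy i j with h | h | h
    · exact absurd hij (dual_ne_of_lt hr he h)
    · exact h
    · exact absurd hij.symm (dual_ne_of_lt hr he h)
  · intro n
    rw [ht]
    exact hsub _
  · intro n
    rw [ht]
    exact hsep _
  · intro n h
    exact absurd ((mem_entered_iff hr he).1 h) (not_lt.2 (t n).2.1)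

/-- Every non-regular point has a smallest standard subcomplex, and it is contained in a join
standard subcomplex. -/
theorem exists_isSmallestFor [Finite V] (ξ : NonRegular Γ) :
    ∃ Y : StandardInJoin Γ, IsSmallestFor Y.1 ξ.1 := by
  obtain ⟨r, hr, hξ⟩ := exists_ray ξ.1
  obtain ⟨N, hN⟩ := exists_labels_subset_recurrentLabels r
  obtain ⟨Λ, hΛ, hsub⟩ := exists_isJoin_of_not_regular hr hξ ξ.2
  exact ⟨⟨standard Γ (r N) (recurrentLabels r), isStandard_standard _ _,
    standard Γ (r N) Λ, ⟨Λ, hΛ, isStandardOfType_iff.2 ⟨_, rfl⟩⟩, standard_mono hsub⟩,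
    isSmallestFor_of_isLeast hr hξ (isLeast_standard hr hN)⟩

end Salvetti

theorem theorem7 {V : Type*} [Finite V] (Γ : SimpleGraph V) :
    MeasurableSet (Salvetti.regularPoints Γ) ∧
    (∀ ξ : Salvetti.NonRegular Γ,
      ∃! Y : Set (Salvetti.Cube Γ), Salvetti.IsStandard Γ Y ∧ Salvetti.IsSmallestFor Y ξ.1) ∧
    ∃! Φ : Salvetti.NonRegular Γ → Salvetti.StandardInJoin Γ,
      Measurable Φ ∧
      (∀ (g : Salvetti.RAAG Γ) (ξ : Salvetti.NonRegular Γ), Φ (g • ξ) = g • Φ ξ) ∧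
      ∀ ξ : Salvetti.NonRegular Γ, Salvetti.IsSmallestFor (Φ ξ).1 ξ.1 := by
  choose Φ hΦ using fun ξ : Salvetti.NonRegular Γ => Salvetti.exists_isSmallestFor ξ
  refine ⟨Salvetti.measurableSet_regularPoints, fun ξ => ⟨(Φ ξ).1, ⟨(Φ ξ).2.1, hΦ ξ⟩,
    fun Y hY => hY.2.unique (hΦ ξ)⟩, Φ, ⟨?_, ?_, hΦ⟩, ?_⟩
  -- The target is countable, so measurability of the fibres is enough.
  · refine measurable_to_countable' fun Y => ?_
    have : Φ ⁻¹' {Y} = Subtype.val ⁻¹' {ξ | Salvetti.IsSmallestFor Y.1 ξ} := by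
      ext ξ
      refine ⟨fun h => ?_, fun h => Subtype.ext ((hΦ ξ).unique h)⟩
      have h' : Φ ξ = Y := h
      exact h' ▸ hΦ ξ
    rw [this]
    exact measurable_subtype_coe (Salvetti.measurableSet_isSmallestFor Y.2.1)
  · exact fun g ξ => Subtype.ext ((hΦ (g • ξ)).unique ((hΦ ξ).smul (Φ ξ).2.1 g))
  -- The pointwise minimality condition alone determines the map.
  · rintro Ψ ⟨-, -, hΨ⟩
    funext ξ
    exact Subtype.ext ((hΨ ξ).unique (hΦ ξ))
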